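/- Let $\mathcal C$ be a closed symmetric monoidal category with tensor product $\otimes$, unit $c$ and internal hom $[-,-]$, which has all finite limits and finite colimits, and let $b=(b,u_b,m_b)$ be a monoid in $\mathcal C$. Let $\mathcal Mod_b$ be the $\mathcal C$-category of right $b$-modules $z_b=(z,\gamma_z:z\otimes b\to z)$, whose hom object from $z_b$ to $\tilde z_b$ is the equalizer of the two morphisms $[z,\tilde z]\rightrightarrows[z\otimes b,\tilde z]$ that express $b$-linearity; it is tensored by $w\circledast z_b=(w\otimes z,\,1_w\otimes\gamma_z)$. Write $b_b=(b,m_b)$. Let $\mathcal D$ be a tensored $\mathcal C$-category, i.e. there are objects $z\circledast X$ with $\mathcal C$-natural isomorphisms $\mathcal D(z\circledast X,Y)\cong[z,\mathcal D(X,Y)]$, and assume that its underlying category $\mathcal D_0$ has coequalizers. Let $\mathcal F:\mathcal Mod_b\to\mathcal D$ be a $\mathcal C$-functor. We use the following notation. * For $z\in\mathcal C$ and $X\in\mathcal Mod_b$, the strength $t^{\mathcal F}_{z,X}:z\circledast\mathcal F(X)\to\mathcal F(z\circledast X)$ is the morphism that corresponds to $z\to\mathcal Mod_b(X,z\circledast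 X)\to\mathcal D(\mathcal F(X),\mathcal F(z\circledast X))$. $\mathcal F$ *preserves $\mathcal C$-tensors* if every $t^{\mathcal F}_{z,X}$ is an isomorphism. * $\mathcal F(b_b)$ is a left $b$-module in $\mathcal D$ through $\rho=\mathcal F(m_b)\circ t^{\mathcal F}_{b,b_b}:b\circledast\mathcal F(b_b)\to\mathcal F(b_b)$, where $m_b$ is regarded as a module map $b\circledast b_b\to b_b$. For $z_b\in\mathcal Mod_b$, let $cq_z:z\circledast\mathcal F(b_b)\to z_b\circledast_b\mathcal F(b_b)$ be the coequalizer in $\mathcal D_0$ of the two morphisms $z\circledast(b\circledast\mathcal F(b_b))\rightrightarrows z\circledast\mathcal F(b_b)$ given by $\gamma_z$ (after the associativity isomorphism) and by $1_z\circledast\rho$. * $\lambda^{\mathcal F}_{z}:z_b\circledast_b\mathcal F(b_b)\to\mathcal F(z_b)$ is the unique morphism with $\lambda^{\mathcal F}_z\circ cq_z=\mathcal F(\gamma_z)\circ t^{\mathcal F}_{z,b_b}$, where $\gamma_z$ is regarded as a module map $z\circledast b_b\to z_b$. * $-\circledast_b\mathcal F(b_b)$ *is $\mathcal C$-enriched*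 if for all $w\in\mathcal C$ and $z_b\in\mathcal Mod_b$ there is an isomorphism $a_{w,z}:w\circledast(z_b\circledast_b\mathcal F(b_b))\to(w\circledast z_b)\circledast_b\mathcal F(b_b)$ such that $a_{w,z}\circ(1_w\circledast cq_z)$ is the composite of $cq_{w\otimes z}$ with the associativity isomorphism $w\circledast(z\circledast\mathcal F(b_b))\cong(w\otimes z)\circledast\mathcal F(b_b)$. In this case the $a_{w,z}$ are unique and are the strengths of a unique $\mathcal C$-functor structure on $-\circledast_b\mathcal F(b_b):\mathcal Mod_b\to\mathcal D$, and $\lambda^{\mathcal F}:-\circledast_b\mathcal F(b_b)\Rightarrow\mathcal F$ is a $\mathcal C$-natural transformation. **Proposition.** The following are equivalent: 1. $\mathcal F$ is a $\mathcal C$-enriched left adjoint, i.e. it has a right adjoint $\mathcal C$-functor $\mathcal D\to\mathcal Mod_b$, with $\mathcal C$-natural unit and counit; 2. $\mathcal F$ is $\mathcal C$-enriched cocontinuous, i.e. it preserves every weighted colimit that exists in $\mathcal Mod_b$ (with weight any $\mathcal C$-functor $\mathcal J^{op}\to\mathcal C$ on a small $\mathcal C$-category $\mathcal J$); 3. $\mathcal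 F$ preserves $\mathcal C$-tensors, and the underlying functor $\mathcal F_0$ preserves coequalizers; 4. $-\circledast_b\mathcal F(b_b)$ is $\mathcal C$-enriched, and the $\mathcal C$-natural transformation $\lambda^{\mathcal F}:-\circledast_b\mathcal F(b_b)\Rightarrow\mathcal F$ is invertible. Moreover, if $w\circledast-:\mathcal D_0\to\mathcal D_0$ preserves coequalizers for every $w\in\mathcal C$, then $-\circledast_b\mathcal F(b_b)$ is $\mathcal C$-enriched, so that (4) only says that $\lambda^{\mathcal F}$ is invertible. -/

import Mathlib

universe w v u u₁ u₂
open CategoryTheory MonoidalCategory MonoidalClosed Limits Opposite MonObj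
noncomputable section
namespace EnrichedModules

section RightModules
variable {C : Type u} [Category.{v} C] [MonoidalCategory C] [SymmetricCategory C]

/-- A right module `z ⊗ b ⟶ z` over the monoid `b`. -/
structure RightMod (b : C) [MonObj b] where
  X : C
  act : X ⊗ b ⟶ X
  act_one : X ◁ η[b] ≫ act = (ρ_ X).hom
  act_mul : X ◁ μ[b] ≫ act = (α_ X b b).inv ≫ act ▷ b ≫ act

/-- The symmetry `(z ⊗ b) ⊗ h ⟶ (z ⊗ h) ⊗ b` exchanging `b` and `h`. -/
def swapRight (z b h : C) : (z ⊗ b) ⊗ h ⟶ (z ⊗ h) ⊗ b :=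
  (α_ z b h).hom ≫ z ◁ (β_ b h).hom ≫ (α_ z h b).inv

lemma swapRight_whiskerLeft {h h' : C} (z b : C) (g : h ⟶ h') :
    (z ⊗ b) ◁ g ≫ swapRight z b h' = swapRight z b h ≫ (z ◁ g) ▷ b := by
  simp only [swapRight, tensor_whiskerLeft, Category.assoc, Iso.inv_hom_id_assoc,
    whisker_assoc, Iso.cancel_iso_hom_left]
  rw [← MonoidalCategory.whiskerLeft_comp_assoc, BraidedCategory.braiding_naturality_right]
  simp

lemma swapRight_whiskerRight {z z' : C} (b h : C) (f : z ⟶ z') :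
    f ▷ b ▷ h ≫ swapRight z' b h = swapRight z b h ≫ f ▷ h ▷ b := by
  simp only [swapRight, Category.assoc, associator_naturality_left_assoc,
    ← whisker_exchange_assoc, associator_inv_naturality_left]

namespace RightMod
variable {b : C} [MonObj b]

/-- A family `z ⊗ t ⟶ y` of maps of right `b`-modules, parametrised by `t`, is `b`-linear. -/
def IsLinear (z y : RightMod b) {t : C} (f : z.X ⊗ t ⟶ y.X) : Prop :=
  z.act ▷ t ≫ f = swapRight z.X b t ≫ f ▷ b ≫ y.act

lemma IsLinear.precomp {z y : RightMod b} {t t' : C} {f : z.X ⊗ t ⟶ y.X} (hf : IsLinear z y f)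
    (g : t' ⟶ t) : IsLinear z y (z.X ◁ g ≫ f) := by
  rw [IsLinear, ← whisker_exchange_assoc, hf, ← Category.assoc, swapRight_whiskerLeft]
  simp

lemma isLinear_id (z : RightMod b) : IsLinear z z (ρ_ z.X).hom := by
  simp [IsLinear, swapRight]

lemma IsLinear.comp {x y z : RightMod b} {s t : C} {f : x.X ⊗ s ⟶ y.X} {g : y.X ⊗ t ⟶ z.X}
    (hf : IsLinear x y f) (hg : IsLinear y z g) :
    IsLinear x z ((α_ x.X s t).inv ≫ f ▷ t ≫ g) := by
  have h1 : x.act ▷ (s ⊗ t) ≫ (α_ x.X s t).inv ≫ f ▷ t ≫ g =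
      (α_ _ _ _).inv ≫ (x.act ▷ s ≫ f) ▷ t ≫ g := by simp
  rw [IsLinear, h1, hf]
  simp only [comp_whiskerRight, Category.assoc]
  rw [hg, ← Category.assoc (f ▷ b ▷ t), swapRight_whiskerRight]
  simp only [← Category.assoc]
  congr 3
  simp only [swapRight, BraidedCategory.braiding_tensor_right_hom]
  simp

/-- The right module `w ⊗ z`, with `b` acting on `z`. -/
abbrev tensor (w : C) (z : RightMod b) : RightMod b where
  X := w ⊗ z.X
  act := (α_ w z.X b).hom ≫ w ◁ z.act
  act_one := by
    simp [← MonoidalCategory.whiskerLeft_comp, z.act_one]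
  act_mul := by
    simp [← MonoidalCategory.whiskerLeft_comp, z.act_mul]

variable (b) in
/-- The monoid `b` as a right module over itself. -/
abbrev regular : RightMod b where
  X := b
  act := μ[b]
  act_one := by simp
  act_mul := by simp

lemma isLinear_braiding (w : C) (z : RightMod b) :
    IsLinear z (tensor w z) (β_ z.X w).hom := by
  simp [IsLinear, tensor, swapRight]

lemma IsLinear.swap {w t : C} {z y : RightMod b} {g : z.X ⊗ w ⊗ t ⟶ y.X} (hg : IsLinear z y g) :
    IsLinear (tensor w z) y ((β_ w z.X).hom ▷ t ≫ (α_ _ _ _).hom ≫ g) := by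
  have h1 : (tensor w z).act ▷ t ≫ (β_ w z.X).hom ▷ t ≫ (α_ _ _ _).hom ≫ g =
      (α_ w z.X b).hom ▷ t ≫ (β_ w (z.X ⊗ b)).hom ▷ t ≫ (α_ _ _ _).hom ≫ z.act ▷ (w ⊗ t) ≫ g := by
    dsimp only [tensor]
    rw [comp_whiskerRight_assoc, ← comp_whiskerRight_assoc (w ◁ z.act),
      BraidedCategory.braiding_naturality_right, comp_whiskerRight_assoc,
      associator_naturality_left_assoc]
  rw [IsLinear, h1, hg]
  simp only [comp_whiskerRight, ← Category.assoc]
  congr 2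
  simp only [swapRight, BraidedCategory.braiding_tensor_right_hom]
  have e : z.X ◁ (β_ w b).hom ▷ t ≫ z.X ◁ (β_ b w).hom ▷ t = 𝟙 _ := by
    rw [← MonoidalCategory.whiskerLeft_comp, ← comp_whiskerRight, SymmetricCategory.symmetry]
    simp
  simp only [comp_whiskerRight, whisker_assoc, Category.assoc,
    MonoidalCategory.whiskerLeft_comp]
  calc _ = (α_ _ _ _).hom ≫ ((β_ w z.X).hom ▷ (b ⊗ t) ≫ (z.X ⊗ w) ◁ (β_ b t).hom) ≫
        (α_ _ _ _).inv ≫ (α_ z.X w t).hom ▷ b := by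
        simp [reassoc_of% e]
    _ = _ := by
        rw [← whisker_exchange]
        simp

lemma isLinear_of_equivariant {x y : RightMod b} (f : x.X ⟶ y.X)
    (hf : x.act ≫ f = f ▷ b ≫ y.act) : IsLinear x y ((ρ_ x.X).hom ≫ f) := by
  simp only [IsLinear, comp_whiskerRight, Category.assoc, ← hf]
  simp [swapRight]

variable [MonoidalClosed C]

/-- The map `[x, y] ⟶ [x ⊗ b, y ⊗ b]` which the enriched functor `- ⊗ b` induces on hom objects. -/
def tensorRightMap (x y b : C) : (ihom x).obj y ⟶ (ihom (x ⊗ b)).obj (y ⊗ b) :=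
  curry (swapRight x b _ ≫ (ihom.ev x).app y ▷ b)

lemma equalizes_iff_isLinear (z y : RightMod b) {t : C} (f : z.X ⊗ t ⟶ y.X) :
    curry f ≫ (pre z.act).app y.X =
      curry f ≫ tensorRightMap z.X y.X b ≫ (ihom (z.X ⊗ b)).map y.act ↔ IsLinear z y f := by
  rw [curry_pre_app, tensorRightMap, ← curry_natural_right, ← curry_natural_left,
    (curry_injective (A := z.X ⊗ b)).eq_iff, IsLinear]
  simp only [← Category.assoc]
  rw [swapRight_whiskerLeft]
  simp only [Category.assoc]
  rw [← comp_whiskerRight_assoc, whiskerLeft_curry_ihom_ev_app]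

variable [HasEqualizers C]

/-- The object of module maps: the equalizer of precomposition with the action of `z` and of
`- ⊗ b` followed by postcomposition with the action of `y`. -/
abbrev preHom (z y : RightMod b) : C :=
  equalizer ((pre z.act).app y.X) (tensorRightMap z.X y.X b ≫ (ihom (z.X ⊗ b)).map y.act)

/-- A `b`-linear family `z ⊗ t ⟶ y` as a `t`-element of the object of module maps. -/
def preMk (z y : RightMod b) {t : C} (f : z.X ⊗ t ⟶ y.X) (hf : IsLinear z y f) : t ⟶ preHom z y :=
  equalizer.lift (curry f) ((equalizes_iff_isLinear z y f).2 hf)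

/-- Evaluation `z ⊗ hom z y ⟶ y`. -/
def preEv (z y : RightMod b) : z.X ⊗ preHom z y ⟶ y.X := uncurry (equalizer.ι _ _)

lemma whiskerLeft_preMk_preEv (z y : RightMod b) {t : C} (f : z.X ⊗ t ⟶ y.X)
    (hf : IsLinear z y f) : z.X ◁ preMk z y f hf ≫ preEv z y = f := by
  rw [preEv, ← uncurry_natural_left, preMk, equalizer.lift_ι, uncurry_curry]

lemma pre_ext {z y : RightMod b} {t : C} {f g : t ⟶ preHom z y}
    (h : z.X ◁ f ≫ preEv z y = z.X ◁ g ≫ preEv z y) : f = g := by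
  apply equalizer.hom_ext
  apply uncurry_injective
  simpa only [preEv, ← uncurry_natural_left] using h

lemma isLinear_preEv (z y : RightMod b) : IsLinear z y (preEv z y) := by
  rw [← equalizes_iff_isLinear, preEv, curry_uncurry]
  exact equalizer.condition _ _

/-- The identity of a module, as an element of the object of module maps. -/
def preId (z : RightMod b) : 𝟙_ C ⟶ preHom z z := preMk z z _ (isLinear_id z)

/-- Composition of module maps: evaluate twice. -/
def preComp (x y z : RightMod b) : preHom x y ⊗ preHom y z ⟶ preHom x z :=
  preMk x z _ ((isLinear_preEv x y).comp (isLinear_preEv y z))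

/-- The `C`-category of right `b`-modules. (Composition in Mathlib's enriched categories is
`Hom X Y ⊗ Hom Y Z ⟶ Hom X Z`.) -/
instance : EnrichedCategory C (RightMod b) where
  Hom := preHom
  id := preId
  comp := preComp
  id_comp x y := by
    apply pre_ext
    simp only [preId, preComp, MonoidalCategory.whiskerLeft_comp, Category.assoc,
      whiskerLeft_preMk_preEv, associator_inv_naturality_middle_assoc]
    rw [← comp_whiskerRight_assoc, whiskerLeft_preMk_preEv]
    simp
  comp_id x y := by
    apply pre_ext
    simp only [preId, preComp, MonoidalCategory.whiskerLeft_comp, Category.assoc,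
      whiskerLeft_preMk_preEv, associator_inv_naturality_right_assoc, whisker_exchange_assoc]
    simp
  assoc x y z t := by
    apply pre_ext
    simp only [preComp, MonoidalCategory.whiskerLeft_comp, Category.assoc,
      whiskerLeft_preMk_preEv, associator_inv_naturality_right_assoc, whisker_exchange_assoc,
      associator_inv_naturality_middle_assoc]
    rw [← comp_whiskerRight_assoc, whiskerLeft_preMk_preEv]
    simp

/-- A `b`-linear family `z ⊗ t ⟶ y` as a `t`-element of the hom object. -/
def homMk (z y : RightMod b) {t : C} (f : z.X ⊗ t ⟶ y.X) (hf : IsLinear z y f) :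
    t ⟶ (z ⟶[C] y) := preMk z y f hf

/-- Evaluation `z ⊗ (z ⟶[C] y) ⟶ y`. -/
def homEv (z y : RightMod b) : z.X ⊗ (z ⟶[C] y) ⟶ y.X := preEv z y

lemma whiskerLeft_homMk_homEv (z y : RightMod b) {t : C} (f : z.X ⊗ t ⟶ y.X)
    (hf : IsLinear z y f) : z.X ◁ homMk z y f hf ≫ homEv z y = f :=
  whiskerLeft_preMk_preEv z y f hf

lemma hom_ext {z y : RightMod b} {t : C} {f g : t ⟶ (z ⟶[C] y)}
    (h : z.X ◁ f ≫ homEv z y = z.X ◁ g ≫ homEv z y) : f = g := pre_ext h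

lemma isLinear_homEv (z y : RightMod b) : IsLinear z y (homEv z y) := isLinear_preEv z y

lemma whiskerLeft_eId_homEv (x : RightMod b) : x.X ◁ eId C x ≫ homEv x x = (ρ_ _).hom :=
  whiskerLeft_homMk_homEv _ _ _ (isLinear_id x)

lemma whiskerLeft_eComp_homEv (x y z : RightMod b) :
    x.X ◁ eComp C x y z ≫ homEv x z = (α_ _ _ _).inv ≫ homEv x y ▷ _ ≫ homEv y z :=
  whiskerLeft_homMk_homEv _ _ _ ((isLinear_homEv x y).comp (isLinear_homEv y z))

end RightMod
end RightModules

section Elements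
open ForgetEnrichment
variable {C : Type u} [Category.{v} C] [MonoidalCategory C]
  {D : Type u₁} [EnrichedCategory C D] {E : Type u₂} [EnrichedCategory C E]

/-- Composition of two elements (of shapes `s` and `t`) of hom objects of a `C`-category. -/
def eMul {s t : C} {X Y Z : D} (f : s ⟶ (X ⟶[C] Y)) (g : t ⟶ (Y ⟶[C] Z)) :
    s ⊗ t ⟶ (X ⟶[C] Z) :=
  (f ⊗ₘ g) ≫ eComp C X Y Z

/-- A morphism of the underlying category, seen as an element of the hom object. -/
def toHom {X Y : D} (f : of C X ⟶ of C Y) : 𝟙_ C ⟶ (X ⟶[C] Y) := f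

/-- An element of the hom object, seen as a morphism of the underlying category. -/
def ofHom {X Y : D} (f : 𝟙_ C ⟶ (X ⟶[C] Y)) : of C X ⟶ of C Y := f

lemma toHom_id (X : D) : toHom (𝟙 (of C X)) = eId C X := homTo_id C (of C X)

lemma toHom_comp {X Y Z : D} (f : of C X ⟶ of C Y) (g : of C Y ⟶ of C Z) :
    toHom (f ≫ g) = (λ_ (𝟙_ C)).inv ≫ eMul (toHom f) (toHom g) :=
  (homTo_comp C f g).trans (Category.assoc _ _ _)

/-- Postcomposition of an element of a hom object with a morphism of the underlying category. -/
def postcomp {s : C} {X Y Z : D} (f : s ⟶ (X ⟶[C] Y)) (g : of C Y ⟶ of C Z) :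
    s ⟶ (X ⟶[C] Z) :=
  (ρ_ s).inv ≫ eMul f (toHom g)

/-- Precomposition of an element of a hom object with a morphism of the underlying category. -/
def precomp {t : C} {X Y Z : D} (f : of C X ⟶ of C Y) (g : t ⟶ (Y ⟶[C] Z)) :
    t ⟶ (X ⟶[C] Z) :=
  (λ_ t).inv ≫ eMul (toHom f) g

lemma eMul_assoc {r s t : C} {X Y Z W : D} (f : r ⟶ (X ⟶[C] Y)) (g : s ⟶ (Y ⟶[C] Z))
    (h : t ⟶ (Z ⟶[C] W)) : eMul (eMul f g) h = (α_ r s t).hom ≫ eMul f (eMul g h) := by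
  have := e_assoc' C X Y Z W
  simp only [eMul]
  calc ((f ⊗ₘ g) ≫ eComp C X Y Z ⊗ₘ h) ≫ eComp C X Z W
      = ((f ⊗ₘ g) ⊗ₘ h) ≫ eComp C X Y Z ▷ _ ≫ eComp C X Z W := by
        rw [← tensorHom_id, tensorHom_comp_tensorHom_assoc, Category.comp_id]
    _ = _ := by
        rw [← this, associator_naturality_assoc, tensorHom_comp_whiskerLeft_assoc]

lemma comp_eMul_comp {s t s' t' : C} {X Y Z : D} (p : s' ⟶ s) (q : t' ⟶ t)
    (f : s ⟶ (X ⟶[C] Y)) (g : t ⟶ (Y ⟶[C] Z)) :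
    eMul (p ≫ f) (q ≫ g) = (p ⊗ₘ q) ≫ eMul f g := by
  simp [eMul]

lemma eMul_comp {s t t' : C} {X Y Z : D} (q : t' ⟶ t)
    (f : s ⟶ (X ⟶[C] Y)) (g : t ⟶ (Y ⟶[C] Z)) :
    eMul f (q ≫ g) = s ◁ q ≫ eMul f g := by
  simpa using comp_eMul_comp (𝟙 _) q f g

lemma comp_eMul {s t s' : C} {X Y Z : D} (p : s' ⟶ s)
    (f : s ⟶ (X ⟶[C] Y)) (g : t ⟶ (Y ⟶[C] Z)) :
    eMul (p ≫ f) g = p ▷ t ≫ eMul f g := by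
  simpa using comp_eMul_comp p (𝟙 _) f g

lemma eMul_eId {s : C} {X Y : D} (f : s ⟶ (X ⟶[C] Y)) : eMul f (eId C Y) = (ρ_ s).hom ≫ f := by
  have := e_comp_id C X Y
  rw [Iso.inv_comp_eq] at this
  rw [eMul, MonoidalCategory.tensorHom_def, Category.assoc, this]
  simp

lemma eId_eMul {s : C} {X Y : D} (f : s ⟶ (X ⟶[C] Y)) : eMul (eId C X) f = (λ_ s).hom ≫ f := by
  have := e_id_comp C X Y
  rw [Iso.inv_comp_eq] at this
  rw [eMul, MonoidalCategory.tensorHom_def', Category.assoc, this]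
  simp

lemma eMul_map (F : EnrichedFunctor C D E) {s t : C} {X Y Z : D}
    (f : s ⟶ (X ⟶[C] Y)) (g : t ⟶ (Y ⟶[C] Z)) :
    eMul f g ≫ F.map X Z = eMul (f ≫ F.map X Y) (g ≫ F.map Y Z) := by
  simp [eMul]

/-- The action of the underlying functor on morphisms of the underlying category. -/
def mapHom (F : EnrichedFunctor C D E) {X Y : D} (f : of C X ⟶ of C Y) :
    of C (F.obj X) ⟶ of C (F.obj Y) := F.forget.map f

lemma postcomp_map (F : EnrichedFunctor C D E) {s : C} {X Y Z : D}
    (f : s ⟶ (X ⟶[C] Y)) (g : of C Y ⟶ of C Z) :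
    postcomp f g ≫ F.map X Z = postcomp (f ≫ F.map X Y) (mapHom F g) := by
  simp only [postcomp, Category.assoc, eMul_map]; rfl

lemma postcomp_id {s : C} {X Y : D} (f : s ⟶ (X ⟶[C] Y)) : postcomp f (𝟙 (of C Y)) = f := by
  rw [postcomp, toHom_id, eMul_eId]; simp

lemma postcomp_comp {s : C} {X Y Z W : D} (f : s ⟶ (X ⟶[C] Y)) (g : of C Y ⟶ of C Z)
    (h : of C Z ⟶ of C W) : postcomp f (g ≫ h) = postcomp (postcomp f g) h := by
  simp only [postcomp, toHom_comp, eMul_comp, comp_eMul, eMul_assoc]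
  simp only [← Category.assoc]
  congr 1
  simp [unitors_inv_equal]

lemma precomp_id {s : C} {X Y : D} (f : s ⟶ (X ⟶[C] Y)) : precomp (𝟙 (of C X)) f = f := by
  rw [precomp, toHom_id, eId_eMul]; simp

lemma comp_postcomp {s t : C} {X Y Z : D} (p : t ⟶ s) (f : s ⟶ (X ⟶[C] Y)) (g : of C Y ⟶ of C Z) :
    postcomp (p ≫ f) g = p ≫ postcomp f g := by
  simp [postcomp, comp_eMul]

lemma comp_precomp {s t : C} {X Y Z : D} (p : t ⟶ s) (f : of C X ⟶ of C Y) (g : s ⟶ (Y ⟶[C] Z)) :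
    precomp f (p ≫ g) = p ≫ precomp f g := by
  simp [precomp, eMul_comp]

lemma eMul_precomp {s t : C} {X Y Z W : D} (f : s ⟶ (X ⟶[C] Y)) (g : of C Y ⟶ of C Z)
    (h : t ⟶ (Z ⟶[C] W)) : eMul f (precomp g h) = eMul (postcomp f g) h := by
  simp [precomp, postcomp, eMul_comp, comp_eMul, eMul_assoc]

lemma eMul_postcomp {s t : C} {X Y Z W : D} (f : s ⟶ (X ⟶[C] Y)) (g : t ⟶ (Y ⟶[C] Z))
    (h : of C Z ⟶ of C W) : eMul f (postcomp g h) = postcomp (eMul f g) h := by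
  simp [postcomp, eMul_comp, eMul_assoc]

lemma precomp_postcomp {s : C} {X Y Z W : D} (f : of C X ⟶ of C Y) (g : s ⟶ (Y ⟶[C] Z))
    (h : of C Z ⟶ of C W) : precomp f (postcomp g h) = postcomp (precomp f g) h := by
  simp only [precomp, eMul_postcomp, comp_postcomp]

lemma precomp_comp {s : C} {X Y Z W : D} (f : of C X ⟶ of C Y) (g : of C Y ⟶ of C Z)
    (h : s ⟶ (Z ⟶[C] W)) : precomp (f ≫ g) h = precomp f (precomp g h) := by
  simp only [precomp, toHom_comp, eMul_comp, comp_eMul, eMul_assoc]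
  simp only [← Category.assoc]
  congr 1
  simp

end Elements

section Tensors
open ForgetEnrichment
variable (C : Type u) [Category.{v} C] [MonoidalCategory C] [MonoidalClosed C]

/-- The map `D(P, Y) ⟶ [z, D(X, Y)]` that precomposes with `cv : z ⟶ D(X, P)`. -/
def tensorComparison {D : Type u₁} [EnrichedCategory C D] {z : C} {X P : D}
    (cv : z ⟶ (X ⟶[C] P)) (Y : D) : (P ⟶[C] Y) ⟶ (ihom z).obj (X ⟶[C] Y) :=
  curry (cv ▷ (P ⟶[C] Y) ≫ eComp C X P Y)

/-- A choice of tensors in the `C`-category `D`: for all `z` in `C` and `X` in `D` an object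
`z ⊙ X` and a map `cv : z ⟶ D(X, z ⊙ X)` inducing isomorphisms `D(z ⊙ X, Y) ≅ [z, D(X, Y)]`
for all `Y`. Equivalently, each `C`-functor `D(X, -) : D ⥤ C` has a `C`-enriched left adjoint
`- ⊙ X`, with unit `cv`. -/
class Tensored (D : Type u₁) [EnrichedCategory C D] where
  tensorObj : C → D → D
  cv (z : C) (X : D) : z ⟶ (X ⟶[C] tensorObj z X)
  isIso_comparison (z : C) (X Y : D) : IsIso (tensorComparison C (cv z X) Y)

attribute [instance] Tensored.isIso_comparison

variable {C} {D : Type u₁} [EnrichedCategory C D] [Tensored C D]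
  {E : Type u₂} [EnrichedCategory C E] [Tensored C E]

/-- The tensor of `z` in `C` with `X` in `D`. -/
abbrev tens (z : C) (X : D) : D := Tensored.tensorObj z X

infixr:70 " ⊙ " => tens

/-- The unit `z ⟶ D(X, z ⊙ X)` of the adjunction between `- ⊙ X` and `D(X, -)`. -/
def cv (z : C) (X : D) : z ⟶ (X ⟶[C] (z ⊙ X)) := Tensored.cv z X

/-- The `t`-element of `D(z ⊙ X, Y)` corresponding to a map `z ⊗ t ⟶ D(X, Y)`. -/
def eDesc {z t : C} {X Y : D} (f : z ⊗ t ⟶ (X ⟶[C] Y)) : t ⟶ ((z ⊙ X) ⟶[C] Y) :=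
  curry f ≫ inv (tensorComparison C (Tensored.cv z X) Y)

lemma curry_eMul_cv {z t : C} {X Y : D} (g : t ⟶ ((z ⊙ X) ⟶[C] Y)) :
    curry (eMul (cv z X) g) = g ≫ tensorComparison C (Tensored.cv z X) Y := by
  rw [tensorComparison, ← curry_natural_left, eMul, MonoidalCategory.tensorHom_def',
    Category.assoc]
  rfl

lemma eMul_cv_eDesc {z t : C} {X Y : D} (f : z ⊗ t ⟶ (X ⟶[C] Y)) :
    eMul (cv z X) (eDesc f) = f := by
  apply curry_injective
  rw [curry_eMul_cv, eDesc, Category.assoc, IsIso.inv_hom_id, Category.comp_id]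

lemma eMul_cv_injective {z t : C} {X Y : D} {f g : t ⟶ ((z ⊙ X) ⟶[C] Y)}
    (h : eMul (cv z X) f = eMul (cv z X) g) : f = g := by
  rw [← cancel_mono (tensorComparison C (Tensored.cv z X) Y), ← curry_eMul_cv, h, curry_eMul_cv]

/-- The right adjunct `z ⟶ D(X, Y)` of a morphism `z ⊙ X ⟶ Y`. -/
def rightAdjunct {z : C} {X Y : D} (l : of C (z ⊙ X) ⟶ of C Y) : z ⟶ (X ⟶[C] Y) :=
  postcomp (cv z X) l

/-- The morphism `z ⊙ X ⟶ Y` with a given right adjunct `z ⟶ D(X, Y)`. -/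
def leftAdjunct {z : C} {X Y : D} (f : z ⟶ (X ⟶[C] Y)) : of C (z ⊙ X) ⟶ of C Y :=
  ofHom (eDesc ((ρ_ z).hom ≫ f))

lemma rightAdjunct_leftAdjunct {z : C} {X Y : D} (f : z ⟶ (X ⟶[C] Y)) :
    rightAdjunct (leftAdjunct f) = f := by
  change (ρ_ z).inv ≫ eMul (cv z X) (eDesc ((ρ_ z).hom ≫ f)) = f
  rw [eMul_cv_eDesc, Iso.inv_hom_id_assoc]

lemma rightAdjunct_injective {z : C} {X Y : D} {l l' : of C (z ⊙ X) ⟶ of C Y}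
    (h : rightAdjunct l = rightAdjunct l') : l = l' := by
  simp only [rightAdjunct, postcomp, Iso.cancel_iso_inv_left] at h
  exact eMul_cv_injective h

lemma rightAdjunct_comp {z : C} {X Y Z : D} (l : of C (z ⊙ X) ⟶ of C Y) (g : of C Y ⟶ of C Z) :
    rightAdjunct (l ≫ g) = postcomp (rightAdjunct l) g :=
  postcomp_comp _ _ _

/-- The morphism `f ⊙ g`. -/
def tensorHom {z z' : C} {X X' : D} (f : z ⟶ z') (g : of C X ⟶ of C X') :
    of C (z ⊙ X) ⟶ of C (z' ⊙ X') :=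
  leftAdjunct (f ≫ precomp g (cv z' X'))

lemma rightAdjunct_tensorHom_comp {z z' : C} {X X' Y : D} (f : z ⟶ z') (g : of C X ⟶ of C X')
    (l : of C (z' ⊙ X') ⟶ of C Y) :
    rightAdjunct (tensorHom f g ≫ l) = f ≫ precomp g (rightAdjunct l) := by
  rw [rightAdjunct_comp, tensorHom, rightAdjunct_leftAdjunct, comp_postcomp, rightAdjunct,
    precomp_postcomp]

lemma tensorHom_id_id (z : C) (X : D) : tensorHom (𝟙 z) (𝟙 (of C X)) = 𝟙 (of C (z ⊙ X)) := by
  apply rightAdjunct_injective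
  rw [tensorHom, rightAdjunct_leftAdjunct, Category.id_comp, precomp_id, rightAdjunct, postcomp_id]

lemma tensorHom_id_comp (z : C) {X Y Z : D} (f : of C X ⟶ of C Y) (g : of C Y ⟶ of C Z) :
    tensorHom (𝟙 z) (f ≫ g) = tensorHom (𝟙 z) f ≫ tensorHom (𝟙 z) g := by
  apply rightAdjunct_injective
  rw [rightAdjunct_tensorHom_comp, tensorHom, tensorHom, rightAdjunct_leftAdjunct,
    rightAdjunct_leftAdjunct, Category.id_comp, Category.id_comp, Category.id_comp, precomp_comp]

/-- The canonical morphism `𝟙 ⊙ X ⟶ X`, whose right adjunct is the identity of `X`. -/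
def tensorUnit (X : D) : of C (𝟙_ C ⊙ X) ⟶ of C X := leftAdjunct (eId C X)

/-- The tensorial strength `z ⊙ F X ⟶ F (z ⊙ X)`: its right adjunct is the composite
`z ⟶ D(X, z ⊙ X) ⟶ E(F X, F (z ⊙ X))`. -/
def strength (F : EnrichedFunctor C D E) (z : C) (X : D) :
    of C (z ⊙ F.obj X) ⟶ of C (F.obj (z ⊙ X)) :=
  leftAdjunct (cv z X ≫ F.map X (z ⊙ X))

lemma rightAdjunct_strength_comp_map (F : EnrichedFunctor C D E) {z : C} {X Y : D}
    (l : of C (z ⊙ X) ⟶ of C Y) :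
    rightAdjunct (strength F z X ≫ mapHom F l) = rightAdjunct l ≫ F.map X Y := by
  rw [rightAdjunct_comp, strength, rightAdjunct_leftAdjunct, rightAdjunct, postcomp_map]

variable [BraidedCategory C]

/-- The canonical morphism `w ⊙ (z ⊙ X) ⟶ (w ⊗ z) ⊙ X`: on elements it sends `w ⊙ (z ⊙ x)` to
`(w ⊗ z) ⊙ x`. -/
def tensorAssoc (w z : C) (X : D) : of C (w ⊙ z ⊙ X) ⟶ of C ((w ⊗ z) ⊙ X) :=
  leftAdjunct (eDesc ((β_ z w).hom ≫ cv (w ⊗ z) X))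

lemma eMul_cv_rightAdjunct_tensorAssoc_comp (w z : C) {X Y : D} (l : of C ((w ⊗ z) ⊙ X) ⟶ of C Y) :
    eMul (cv z X) (rightAdjunct (tensorAssoc w z X ≫ l)) = (β_ z w).hom ≫ rightAdjunct l := by
  rw [rightAdjunct_comp, tensorAssoc, rightAdjunct_leftAdjunct, eMul_postcomp, eMul_cv_eDesc,
    comp_postcomp, rightAdjunct]

/-- A `C`-functor preserves tensors if all its tensorial strengths are isomorphisms. -/
def PreservesTensors (F : EnrichedFunctor C D E) : Prop :=
  ∀ (z : C) (X : D), IsIso (strength F z X)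

variable (D) in
/-- The endofunctor `w ⊙ -` of the underlying category of `D`. -/
def tensorLeftFunctor (w : C) : ForgetEnrichment C D ⥤ ForgetEnrichment C D where
  obj X := of C (w ⊙ ForgetEnrichment.to C X)
  map {X Y} f := tensorHom (X := ForgetEnrichment.to C X) (X' := ForgetEnrichment.to C Y) (𝟙 w) f
  map_id X := by
    exact tensorHom_id_id w (ForgetEnrichment.to C X)
  map_comp {X Y Z} f g := by
    exact tensorHom_id_comp w (X := ForgetEnrichment.to C X) (Y := ForgetEnrichment.to C Y)
      (Z := ForgetEnrichment.to C Z) f g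

end Tensors

section TensorsOfModules
variable {C : Type u} [Category.{v} C] [MonoidalCategory C] [SymmetricCategory C]
  [MonoidalClosed C] [HasEqualizers C] {b : C} [MonObj b]
namespace RightMod

/-- The unit `w ⟶ Hom(z, w ⊗ z)` of the tensors of modules. -/
def tensorCv (w : C) (z : RightMod b) : w ⟶ (z ⟶[C] tensor w z) :=
  homMk z (tensor w z) _ (isLinear_braiding w z)

lemma swap_comparison {w t : C} {z y : RightMod b} (g : t ⟶ (tensor w z ⟶[C] y)) :
    z.X ◁ uncurry (g ≫ tensorComparison C (tensorCv w z) y) ≫ homEv z y =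
      (α_ _ _ _).inv ≫ (β_ z.X w).hom ▷ t ≫ (w ⊗ z.X) ◁ g ≫ homEv (tensor w z) y := by
  rw [uncurry_natural_left, tensorComparison, uncurry_curry]
  simp only [MonoidalCategory.whiskerLeft_comp, Category.assoc, whiskerLeft_eComp_homEv,
    associator_inv_naturality_middle_assoc]
  rw [← comp_whiskerRight_assoc, tensorCv, whiskerLeft_homMk_homEv,
    associator_inv_naturality_right_assoc, whisker_exchange_assoc]

lemma isLinear_uncurry {w t : C} {z y : RightMod b} (f : t ⟶ (ihom w).obj (z ⟶[C] y)) :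
    IsLinear (tensor w z) y
      ((β_ w z.X).hom ▷ t ≫ (α_ _ _ _).hom ≫ z.X ◁ uncurry f ≫ homEv z y) :=
  ((isLinear_homEv z y).precomp _).swap

lemma tensor_hom_ext {w t : C} {z y : RightMod b} {f g : t ⟶ (tensor w z ⟶[C] y)}
    (h : f ≫ tensorComparison C (tensorCv w z) y = g ≫ tensorComparison C (tensorCv w z) y) :
    f = g := by
  apply hom_ext
  have := swap_comparison f
  rw [h, swap_comparison] at this
  exact ((cancel_epi _).1 ((cancel_epi _).1 this)).symm

instance (w : C) (z y : RightMod b) : IsIso (tensorComparison C (tensorCv w z) y) := by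
  have h : homMk (tensor w z) y _ (isLinear_uncurry (𝟙 _)) ≫
      tensorComparison C (tensorCv w z) y = 𝟙 _ := by
    apply uncurry_injective
    apply hom_ext
    rw [swap_comparison]
    have := whiskerLeft_homMk_homEv (tensor w z) y _ (isLinear_uncurry (𝟙 _))
    rw [this, ← comp_whiskerRight_assoc, SymmetricCategory.symmetry]
    simp
  refine ⟨homMk (tensor w z) y _ (isLinear_uncurry (𝟙 _)), ?_, h⟩
  apply tensor_hom_ext
  rw [Category.assoc, h, Category.comp_id, Category.id_comp]

/-- The `C`-category of right `b`-modules is tensored, with `w ⊙ z = w ⊗ z`. -/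
instance : Tensored C (RightMod b) where
  tensorObj := tensor
  cv := tensorCv
  isIso_comparison := inferInstance

end RightMod
end TensorsOfModules

section ModuleMorphisms
open ForgetEnrichment
variable {C : Type u} [Category.{v} C] [MonoidalCategory C] [SymmetricCategory C]
  [MonoidalClosed C] [HasEqualizers C] {b : C} [MonObj b]
namespace RightMod

/-- A morphism of `C` compatible with the actions, as a morphism of modules. -/
def ofLinear {x y : RightMod b} (f : x.X ⟶ y.X) (hf : x.act ≫ f = f ▷ b ≫ y.act) :
    of C x ⟶ of C y :=
  ofHom (homMk x y ((ρ_ x.X).hom ≫ f) (isLinear_of_equivariant f hf))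

/-- The morphism of `C` underlying a morphism of modules. -/
def underlying {x y : RightMod b} (l : of C x ⟶ of C y) : x.X ⟶ y.X :=
  (ρ_ x.X).inv ≫ x.X ◁ toHom l ≫ homEv x y

lemma underlying_ofLinear {x y : RightMod b} (f : x.X ⟶ y.X)
    (hf : x.act ≫ f = f ▷ b ≫ y.act) : underlying (ofLinear f hf) = f := by
  have : x.X ◁ toHom (ofLinear f hf) ≫ homEv x y = (ρ_ x.X).hom ≫ f :=
    whiskerLeft_homMk_homEv _ _ _ (isLinear_of_equivariant f hf)
  rw [underlying, this, Iso.inv_hom_id_assoc]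

lemma act_underlying {x y : RightMod b} (l : of C x ⟶ of C y) :
    x.act ≫ underlying l = underlying l ▷ b ≫ y.act := by
  have := (isLinear_homEv x y).precomp (toHom l)
  rw [IsLinear] at this
  rw [underlying, rightUnitor_inv_naturality_assoc, this]
  simp [swapRight]

lemma whiskerLeft_eMul_homEv {s t : C} {x y z : RightMod b} (f : s ⟶ (x ⟶[C] y))
    (g : t ⟶ (y ⟶[C] z)) :
    x.X ◁ eMul f g ≫ homEv x z =
      (α_ _ _ _).inv ≫ (x.X ◁ f ≫ homEv x y) ▷ t ≫ y.X ◁ g ≫ homEv y z := by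
  rw [eMul, MonoidalCategory.whiskerLeft_comp, Category.assoc, whiskerLeft_eComp_homEv,
    MonoidalCategory.tensorHom_def]
  simp only [MonoidalCategory.whiskerLeft_comp, comp_whiskerRight, Category.assoc]
  rw [associator_inv_naturality_right_assoc, whisker_exchange_assoc,
    associator_inv_naturality_middle_assoc]

lemma whiskerLeft_postcomp_homEv {s : C} {x y z : RightMod b} (f : s ⟶ (x ⟶[C] y))
    (g : of C y ⟶ of C z) :
    x.X ◁ postcomp f g ≫ homEv x z = x.X ◁ f ≫ homEv x y ≫ underlying g := by
  rw [postcomp, MonoidalCategory.whiskerLeft_comp, Category.assoc, whiskerLeft_eMul_homEv,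
    underlying]
  simp

lemma whiskerLeft_rightAdjunct_homEv {w : C} {x y : RightMod b} (l : of C (w ⊙ x) ⟶ of C y) :
    x.X ◁ rightAdjunct l ≫ homEv x y = (β_ x.X w).hom ≫ underlying l := by
  have : x.X ◁ cv w x ≫ homEv x (w ⊙ x) = (β_ x.X w).hom :=
    whiskerLeft_homMk_homEv _ _ _ (isLinear_braiding w x)
  rw [rightAdjunct, whiskerLeft_postcomp_homEv, reassoc_of% this]

/-- The action `z ⊗ b ⟶ z` as a morphism of modules `z ⊙ b_b ⟶ z_b`. -/
def actHom (z : RightMod b) : of C (z.X ⊙ regular b) ⟶ of C z :=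
  ofLinear (x := tensor z.X (regular b)) z.act (by
    have := z.act_mul
    dsimp only [tensor, regular]
    rw [Category.assoc, this, Iso.hom_inv_id_assoc])

lemma whiskerLeft_rightAdjunct_actHom_homEv (z : RightMod b) :
    b ◁ rightAdjunct (actHom z) ≫ homEv (regular b) z = (β_ b z.X).hom ≫ z.act := by
  have := whiskerLeft_rightAdjunct_homEv (actHom z)
  rwa [actHom, underlying_ofLinear] at this

lemma eMul_rightAdjunct_actHom {t : C} {z y : RightMod b} (f : t ⟶ (z ⟶[C] y)) :
    eMul (rightAdjunct (actHom z)) f = (z.X ◁ f ≫ homEv z y) ≫ rightAdjunct (actHom y) := by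
  apply hom_ext
  have h : (z.act ▷ t ≫ z.X ◁ f ≫ homEv z y) = _ := (isLinear_homEv z y).precomp f
  have h2 := whiskerLeft_rightAdjunct_actHom_homEv z
  have h3 := whiskerLeft_rightAdjunct_actHom_homEv y
  rw [whiskerLeft_eMul_homEv]
  dsimp only [regular] at *
  rw [h2, comp_whiskerRight_assoc, h, MonoidalCategory.whiskerLeft_comp, Category.assoc, h3,
    BraidedCategory.braiding_naturality_right_assoc, swapRight]
  simp [BraidedCategory.braiding_tensor_right_hom]

lemma one_rightAdjunct_actHom :
    η[b] ≫ rightAdjunct (actHom (regular b)) = eId C (regular b) := by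
  apply hom_ext
  have h3 := whiskerLeft_rightAdjunct_actHom_homEv (regular b)
  rw [whiskerLeft_eId_homEv]
  dsimp only [regular] at *
  rw [MonoidalCategory.whiskerLeft_comp, Category.assoc, h3,
    BraidedCategory.braiding_naturality_right_assoc]
  simp

lemma eMul_rightAdjunct_actHom_actHom (z : RightMod b) :
    eMul (rightAdjunct (actHom (regular b))) (rightAdjunct (actHom z)) =
      (β_ b z.X).hom ≫ z.act ≫ rightAdjunct (actHom z) := by
  rw [eMul_rightAdjunct_actHom]
  have h3 := whiskerLeft_rightAdjunct_actHom_homEv z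
  dsimp only [regular] at *
  rw [h3, Category.assoc]

/-- The counit `Hom(z, y) ⊙ z ⟶ y`. -/
def ev (z y : RightMod b) : of C ((z ⟶[C] y) ⊙ z) ⟶ of C y := leftAdjunct (𝟙 _)

lemma braiding_underlying_ev (z y : RightMod b) :
    (β_ z.X (z ⟶[C] y)).hom ≫ underlying (ev z y) = homEv z y := by
  rw [← whiskerLeft_rightAdjunct_homEv, ev, rightAdjunct_leftAdjunct]
  simp

end RightMod
end ModuleMorphisms

section Enriched
open ForgetEnrichment
variable {C : Type u} [Category.{v} C] [MonoidalCategory C]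
  {D : Type u₁} [EnrichedCategory C D] {E : Type u₂} [EnrichedCategory C E]

/-- A `C`-enriched natural transformation. (Mathlib's `EnrichedNatTrans` is only an ordinary natural
transformation of the underlying functors.) -/
structure EnrichedTrans (F G : EnrichedFunctor C D E) where
  app (X : D) : of C (F.obj X) ⟶ of C (G.obj X)
  naturality (X Y : D) : postcomp (F.map X Y) (app Y) = precomp (app X) (G.map X Y)

/-- The enriched natural transformation has an inverse enriched natural transformation. -/
def EnrichedTrans.IsInvertible {F G : EnrichedFunctor C D E} (α : EnrichedTrans F G) : Prop :=
  ∃ β : EnrichedTrans G F, ∀ X, α.app X ≫ β.app X = 𝟙 _ ∧ β.app X ≫ α.app X = 𝟙 _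

/-- A `C`-enriched adjunction, given by unit, counit and the triangle identities. -/
structure EnrichedAdjunction (F : EnrichedFunctor C D E) (G : EnrichedFunctor C E D) where
  unit : EnrichedTrans (EnrichedFunctor.id C D) (F.comp C G)
  counit : EnrichedTrans (G.comp C F) (EnrichedFunctor.id C E)
  left_triangle (X : D) :
    (mapHom F (unit.app X) : of C (F.obj X) ⟶ of C (F.obj (G.obj (F.obj X)))) ≫
      counit.app (F.obj X) = 𝟙 (of C (F.obj X))
  right_triangle (Y : E) :
    (unit.app (G.obj Y) : of C (G.obj Y) ⟶ of C (G.obj (F.obj (G.obj Y)))) ≫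
      mapHom G (counit.app Y) = 𝟙 (of C (G.obj Y))

/-- The `C`-functor `F` has a `C`-enriched right adjoint. -/
def IsEnrichedLeftAdjoint (F : EnrichedFunctor C D E) : Prop :=
  ∃ G : EnrichedFunctor C E D, Nonempty (EnrichedAdjunction F G)

variable [SymmetricCategory C] [MonoidalClosed C]
section Weighted
open scoped MonoidalClosed
variable {J : Type w} [EnrichedCategory C J]

/-- The contravariant action `W k ⊗ J(j, k) ⟶ W j` of a weight. -/
def weightAct (W : EnrichedFunctor C Jᵒᵖ C) (j k : J) : W.obj (op k) ⊗ (j ⟶[C] k) ⟶ W.obj (op j) :=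
  uncurry (W.map (op k) (op j))

/-- The family `φ j : W j ⊗ t ⟶ D(G j, Y)` is `C`-natural in `j`; such families are the
`t`-elements of the object of `C`-natural transformations `W ⟹ D(G -, Y)`. -/
def IsWeightedFamily (W : EnrichedFunctor C Jᵒᵖ C) (G : EnrichedFunctor C J D) {t : C} {Y : D}
    (φ : ∀ j, W.obj (op j) ⊗ t ⟶ (G.obj j ⟶[C] Y)) : Prop :=
  ∀ j k : J, weightAct W j k ▷ t ≫ φ j =
    (β_ (W.obj (op k)) (j ⟶[C] k)).hom ▷ t ≫ (α_ _ _ _).hom ≫ eMul (G.map j k) (φ k)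

/-- The `C`-natural cocone `ω : W ⟹ D(G -, L)` exhibits `L` as the colimit of `G` weighted by `W`:
for all `Y`, `D(L, Y)` represents the object `∫ j, [W j, D(G j, Y)]` of `C`-natural transformations
`W ⟹ D(G -, Y)`, by composition with `ω`. The universal property of this end is spelled out on
`t`-elements, as `C` need not have all ends. -/
structure IsWeightedColimit (W : EnrichedFunctor C Jᵒᵖ C) (G : EnrichedFunctor C J D) (L : D)
    (ω : ∀ j, W.obj (op j) ⟶ (G.obj j ⟶[C] L)) : Prop where
  isFamily : IsWeightedFamily W G (fun j ↦ (ρ_ (W.obj (op j))).hom ≫ ω j)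
  existsUnique (t : C) (Y : D) (φ : ∀ j, W.obj (op j) ⊗ t ⟶ (G.obj j ⟶[C] Y)) :
    IsWeightedFamily W G φ → ∃! f : t ⟶ (L ⟶[C] Y), ∀ j, eMul (ω j) f = φ j

/-- `F` preserves all weighted colimits that exist in `D`, the weights being indexed by
`C`-categories with object type in `Type w`. -/
def IsEnrichedCocontinuous (F : EnrichedFunctor C D E) : Prop :=
  ∀ (J : Type w) [EnrichedCategory C J] (W : EnrichedFunctor C Jᵒᵖ C)
    (G : EnrichedFunctor C J D) (L : D) (ω : ∀ j, W.obj (op j) ⟶ (G.obj j ⟶[C] L)),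
    IsWeightedColimit W G L ω →
      IsWeightedColimit W (G.comp C F) (F.obj L) (fun j ↦ ω j ≫ F.map (G.obj j) L)
end Weighted
end Enriched

section RelativeTensor
open ForgetEnrichment
variable {C : Type u} [Category.{v} C] [MonoidalCategory C] [SymmetricCategory C]
  [MonoidalClosed C]

/-- A left `b`-module object in the tensored `C`-category `D`. -/
structure LeftModObj (b : C) [MonObj b] (D : Type u₁) [EnrichedCategory C D] [Tensored C D] where
  X : D
  act : of C (b ⊙ X) ⟶ of C X
  one_act : tensorHom η[b] (𝟙 (of C X)) ≫ act = tensorUnit X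
  mul_act : tensorAssoc b b X ≫ tensorHom μ[b] (𝟙 (of C X)) ≫ act =
    tensorHom (𝟙 b) act ≫ act

variable {b : C} [MonObj b] {D : Type u₁} [EnrichedCategory C D] [Tensored C D]

/-- The morphism `z ⊙ b ⊙ X ⟶ z ⊙ X` induced by the action on `z`. -/
def relLeft (z : RightMod b) (X : LeftModObj b D) :
    of C (z.X ⊙ b ⊙ X.X) ⟶ of C (z.X ⊙ X.X) :=
  tensorAssoc z.X b X.X ≫ tensorHom z.act (𝟙 (of C X.X))

/-- The morphism `z ⊙ b ⊙ X ⟶ z ⊙ X` induced by the action on `X`. -/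
def relRight (z : RightMod b) (X : LeftModObj b D) :
    of C (z.X ⊙ b ⊙ X.X) ⟶ of C (z.X ⊙ X.X) :=
  tensorHom (𝟙 z.X) X.act

lemma eMul_cv_rightAdjunct_relLeft {z : RightMod b} {X : LeftModObj b D} {Y : D}
    (k : of C (z.X ⊙ X.X) ⟶ of C Y) :
    eMul (cv b X.X) (rightAdjunct (relLeft z X ≫ k)) =
      (β_ b z.X).hom ≫ z.act ≫ rightAdjunct k := by
  rw [relLeft, Category.assoc, eMul_cv_rightAdjunct_tensorAssoc_comp, rightAdjunct_tensorHom_comp,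
    precomp_id]

lemma eMul_cv_rightAdjunct_relRight {z : RightMod b} {X : LeftModObj b D} {Y : D}
    (k : of C (z.X ⊙ X.X) ⟶ of C Y) :
    eMul (cv b X.X) (rightAdjunct (relRight z X ≫ k)) =
      eMul (rightAdjunct X.act) (rightAdjunct k) := by
  rw [relRight, rightAdjunct_tensorHom_comp, Category.id_comp, eMul_precomp, rightAdjunct]
  rfl

lemma relLeft_eq_relRight_iff {z : RightMod b} {X : LeftModObj b D} {Y : D}
    (k : of C (z.X ⊙ X.X) ⟶ of C Y) :
    relLeft z X ≫ k = relRight z X ≫ k ↔ (β_ b z.X).hom ≫ z.act ≫ rightAdjunct k =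
      eMul (rightAdjunct X.act) (rightAdjunct k) := by
  rw [← eMul_cv_rightAdjunct_relLeft, ← eMul_cv_rightAdjunct_relRight]
  refine ⟨fun h ↦ by rw [h], fun h ↦ rightAdjunct_injective (eMul_cv_injective h)⟩

variable [HasCoequalizers (ForgetEnrichment C D)]

/-- The relative tensor product `z ⊛_b X`, a coequalizer in the underlying category of `D`. -/
def relTensor (z : RightMod b) (X : LeftModObj b D) : D :=
  ForgetEnrichment.to C (coequalizer (relLeft z X) (relRight z X))

/-- The projection `z ⊙ X ⟶ z ⊛_b X`. -/
def cq (z : RightMod b) (X : LeftModObj b D) : of C (z.X ⊙ X.X) ⟶ of C (relTensor z X) :=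
  coequalizer.π (relLeft z X) (relRight z X)

lemma relLeft_cq (z : RightMod b) (X : LeftModObj b D) :
    relLeft z X ≫ cq z X = relRight z X ≫ cq z X := coequalizer.condition _ _

lemma cq_hom_ext {z : RightMod b} {X : LeftModObj b D} {Y : D}
    {f g : of C (relTensor z X) ⟶ of C Y} (h : cq z X ≫ f = cq z X ≫ g) : f = g :=
  coequalizer.hom_ext h

/-- The universal property of `z ⊛_b X`. -/
def relDesc {z : RightMod b} {X : LeftModObj b D} {Y : D} (k : of C (z.X ⊙ X.X) ⟶ of C Y)
    (hk : relLeft z X ≫ k = relRight z X ≫ k) : of C (relTensor z X) ⟶ of C Y :=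
  coequalizer.desc k hk

lemma cq_relDesc {z : RightMod b} {X : LeftModObj b D} {Y : D} (k : of C (z.X ⊙ X.X) ⟶ of C Y)
    (hk : relLeft z X ≫ k = relRight z X ≫ k) : cq z X ≫ relDesc k hk = k :=
  coequalizer.π_desc _ _

variable [HasEqualizers C]

/-- The functoriality of `z ⊛_b X` in the right module `z`. -/
def relMap {z y : RightMod b} (l : of C z ⟶ of C y) (X : LeftModObj b D) :
    of C (relTensor z X) ⟶ of C (relTensor y X) :=
  relDesc (tensorHom (RightMod.underlying l) (𝟙 (of C X.X)) ≫ cq y X) (by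
    have h := (relLeft_eq_relRight_iff _).1 (relLeft_cq y X)
    rw [relLeft_eq_relRight_iff, rightAdjunct_tensorHom_comp, precomp_id, eMul_comp, ← h,
      ← Category.assoc z.act, RightMod.act_underlying]
    simp)

lemma cq_relMap {z y : RightMod b} (l : of C z ⟶ of C y) (X : LeftModObj b D) :
    cq z X ≫ relMap l X = tensorHom (RightMod.underlying l) (𝟙 (of C X.X)) ≫ cq y X :=
  cq_relDesc _ _

/-- The functor `- ⊛_b X` is `C`-enriched: there are isomorphisms
`w ⊙ (z ⊛_b X) ≅ (w ⊙ z) ⊛_b X` compatible with the projections. (They are then unique; see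
`RelTensorIsEnriched.functor` for the resulting `C`-functor.) -/
def RelTensorIsEnriched (X : LeftModObj b D) : Prop :=
  ∀ (w : C) (z : RightMod b),
    ∃ a : of C (w ⊙ relTensor z X) ≅ of C (relTensor (w ⊙ z) X),
      tensorHom (𝟙 w) (cq z X) ≫ a.hom = tensorAssoc w z.X X.X ≫ cq (w ⊙ z) X

namespace RelTensorIsEnriched
variable {X : LeftModObj b D} (h : RelTensorIsEnriched X)

/-- The isomorphism `w ⊙ (z ⊛_b X) ≅ (w ⊙ z) ⊛_b X`. -/
def assoc (w : C) (z : RightMod b) : of C (w ⊙ relTensor z X) ≅ of C (relTensor (w ⊙ z) X) :=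
  (h w z).choose

lemma tensorHom_cq_assoc (w : C) (z : RightMod b) :
    tensorHom (𝟙 w) (cq z X) ≫ (h.assoc w z).hom = tensorAssoc w z.X X.X ≫ cq (w ⊙ z) X :=
  (h w z).choose_spec

lemma eMul_cq_rightAdjunct {w : C} {z : RightMod b} {Y : D}
    (k : of C (w ⊙ relTensor z X) ⟶ of C Y) :
    eMul (rightAdjunct (cq z X)) (rightAdjunct k) =
      (β_ z.X w).hom ≫ rightAdjunct (cq (w ⊙ z) X ≫ (h.assoc w z).inv ≫ k) := by
  rw [rightAdjunct, ← eMul_precomp]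
  have := rightAdjunct_tensorHom_comp (𝟙 w) (cq z X) k
  rw [Category.id_comp] at this
  rw [← this, ← eMul_cv_rightAdjunct_tensorAssoc_comp, ← Category.assoc (tensorAssoc w z.X X.X)]
  have h2 := h.tensorHom_cq_assoc w z
  rw [← Iso.eq_comp_inv] at h2
  rw [h2]
  simp

lemma eMul_cq_injective (h : RelTensorIsEnriched X) {t : C} {z : RightMod b} {Y : D} {f g : t ⟶ (relTensor z X ⟶[C] Y)}
    (hfg : eMul (rightAdjunct (cq z X)) f = eMul (rightAdjunct (cq z X)) g) : f = g := by
  rw [← rightAdjunct_leftAdjunct f, ← rightAdjunct_leftAdjunct g, h.eMul_cq_rightAdjunct,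
    h.eMul_cq_rightAdjunct, cancel_epi] at hfg
  have := (cancel_epi _).1 (cq_hom_ext (rightAdjunct_injective hfg))
  rw [← rightAdjunct_leftAdjunct f, this, rightAdjunct_leftAdjunct]

/-- The action of `- ⊛_b X` on hom objects: its left adjunct is
`Hom(z, y) ⊙ (z ⊛_b X) ≅ (Hom(z, y) ⊙ z) ⊛_b X ⟶ y ⊛_b X`. -/
def mapAux (z y : RightMod b) : (z ⟶[C] y) ⟶ (relTensor z X ⟶[C] relTensor y X) :=
  rightAdjunct ((h.assoc (z ⟶[C] y) z).hom ≫ relMap (RightMod.ev z y) X)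

lemma eMul_cq_mapAux (z y : RightMod b) :
    eMul (rightAdjunct (cq z X)) (h.mapAux z y) =
      RightMod.homEv z y ≫ rightAdjunct (cq y X) := by
  rw [mapAux, h.eMul_cq_rightAdjunct, Iso.inv_hom_id_assoc, cq_relMap,
    rightAdjunct_tensorHom_comp, precomp_id, ← Category.assoc]
  congr 1
  exact RightMod.braiding_underlying_ev z y

/-- The `C`-functor `- ⊛_b X`; its underlying functor and its tensorial strength are computed
below in `mapHom_functor` and `strength_functor`. -/
abbrev functor : EnrichedFunctor C (RightMod b) D where
  obj z := relTensor z X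
  map z y := h.mapAux z y
  map_id z := by
    apply h.eMul_cq_injective
    rw [eMul_comp, eMul_cq_mapAux, eMul_eId, ← Category.assoc, RightMod.whiskerLeft_eId_homEv]
  map_comp x y z := by
    apply h.eMul_cq_injective
    change _ = eMul _ (eMul _ _)
    have e := eMul_assoc (rightAdjunct (cq x X)) (h.mapAux x y) (h.mapAux y z)
    rw [← Iso.inv_comp_eq] at e
    rw [← e, eMul_cq_mapAux, comp_eMul, eMul_cq_mapAux, eMul_comp, eMul_cq_mapAux,
      ← Category.assoc, RightMod.whiskerLeft_eComp_homEv]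
    simp

/-- The underlying functor of `h.functor` is the functor `- ⊛_b X` on underlying categories. -/
lemma mapHom_functor {z y : RightMod b} (l : of C z ⟶ of C y) :
    mapHom h.functor l = relMap l X := by
  apply cq_hom_ext
  apply rightAdjunct_injective
  rw [cq_relMap, rightAdjunct_tensorHom_comp, precomp_id, rightAdjunct_comp, postcomp,
    RightMod.underlying]
  change _ ≫ eMul _ (toHom l ≫ h.mapAux z y) = _
  rw [eMul_comp, eMul_cq_mapAux]
  simp

/-- The tensorial strength of `h.functor` is the given isomorphism. -/
lemma strength_functor (w : C) (z : RightMod b) :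
    strength h.functor w z = (h.assoc w z).hom := by
  apply rightAdjunct_injective
  apply h.eMul_cq_injective
  have e := h.eMul_cq_rightAdjunct (h.assoc w z).hom
  rw [Iso.inv_hom_id, Category.comp_id] at e
  rw [e, strength, rightAdjunct_leftAdjunct]
  change eMul _ (cv w z ≫ h.mapAux z (w ⊙ z)) = _
  rw [eMul_comp, eMul_cq_mapAux, ← Category.assoc]
  congr 1
  exact RightMod.whiskerLeft_homMk_homEv _ _ _ (RightMod.isLinear_braiding w z)

end RelTensorIsEnriched

/-- The left `b`-module object `F(b_b)`, with action `b ⊙ F(b_b) ⟶ F(b ⊙ b_b) ⟶ F(b_b)`. -/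
def evalRegular (F : EnrichedFunctor C (RightMod b) D) : LeftModObj b D where
  X := F.obj (RightMod.regular b)
  act := strength F b (RightMod.regular b) ≫ mapHom F (RightMod.actHom (RightMod.regular b))
  one_act := by
    apply rightAdjunct_injective
    rw [rightAdjunct_tensorHom_comp, precomp_id, rightAdjunct_strength_comp_map, tensorUnit,
      rightAdjunct_leftAdjunct, ← Category.assoc, RightMod.one_rightAdjunct_actHom, F.map_id]
  mul_act := by
    apply rightAdjunct_injective
    apply eMul_cv_injective
    rw [eMul_cv_rightAdjunct_tensorAssoc_comp, rightAdjunct_tensorHom_comp, precomp_id,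
      rightAdjunct_tensorHom_comp, Category.id_comp, eMul_precomp]
    change _ = eMul (rightAdjunct _) _
    rw [rightAdjunct_strength_comp_map, ← eMul_map, RightMod.eMul_rightAdjunct_actHom_actHom]
    simp

/-- The component at `z` of the canonical transformation `- ⊛_b F(b_b) ⟹ F`: the morphism induced
by `z ⊙ F(b_b) ⟶ F(z ⊙ b_b) ⟶ F(z)`. -/
def lambdaApp (F : EnrichedFunctor C (RightMod b) D) (z : RightMod b) :
    of C (relTensor z (evalRegular F)) ⟶ of C (F.obj z) :=
  relDesc (strength F z.X (RightMod.regular b) ≫ mapHom F (RightMod.actHom z)) (by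
    rw [relLeft_eq_relRight_iff]
    have h : rightAdjunct (evalRegular F).act =
      rightAdjunct (RightMod.actHom (RightMod.regular b)) ≫ F.map _ _ :=
        rightAdjunct_strength_comp_map _ _
    rw [h]
    change _ ≫ _ ≫ rightAdjunct (strength F z.X (RightMod.regular b) ≫ _) = eMul _
      (rightAdjunct (strength F z.X (RightMod.regular b) ≫ _))
    rw [rightAdjunct_strength_comp_map, ← eMul_map, RightMod.eMul_rightAdjunct_actHom_actHom]
    simp)

lemma postcomp_cq_lambdaApp (F : EnrichedFunctor C (RightMod b) D) (z : RightMod b) :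
    postcomp (rightAdjunct (cq z (evalRegular F))) (lambdaApp F z) =
      rightAdjunct (RightMod.actHom z) ≫ F.map (RightMod.regular b) z := by
  rw [← rightAdjunct_comp, lambdaApp, cq_relDesc]
  exact rightAdjunct_strength_comp_map _ _

/-- The canonical `C`-enriched natural transformation `- ⊛_b F(b_b) ⟹ F`. -/
def lambda (F : EnrichedFunctor C (RightMod b) D) (h : RelTensorIsEnriched (evalRegular F)) :
    EnrichedTrans h.functor F where
  app := lambdaApp F
  naturality z y := by
    apply h.eMul_cq_injective
    change eMul (rightAdjunct (cq z (evalRegular F)))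
      (postcomp (h.mapAux z y) (lambdaApp F y)) = _
    rw [eMul_postcomp, eMul_precomp, postcomp_cq_lambdaApp, h.eMul_cq_mapAux, comp_postcomp,
      postcomp_cq_lambdaApp]
    have e2 := eMul_map F (rightAdjunct (RightMod.actHom z)) (𝟙 (z ⟶[C] y))
    rw [Category.id_comp] at e2
    refine Eq.trans ?_ e2
    rw [RightMod.eMul_rightAdjunct_actHom]
    simp
    rfl

end RelativeTensor
end EnrichedModules

end

open EnrichedModules

/-!
All four conditions are compared with one instance of preservation of weighted colimits. A left
`b`-module object `X` of `D` is a `C`-functor on the one-object `C`-category `b`, a right `b`-module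
`z` is a weight on it, and the weighted colimit of `X` by `z` is the relative tensor product
`z ⊛_b X` with its *enriched* universal property (`IsRelTensor`): maps `t ⟶ D(z ⊛_b X, Y)` are the
families `z ⊗ t ⟶ D(X, Y)` that are `b`-linear, where `b` acts on `D(X, Y)` through `X`
(`homModule`). Since `Mod(b_b, y) ≅ y`, every module `z` is `z ⊛_b b_b`
(`RightMod.isRelTensor_actHom`). The central condition is that `F` preserves these colimits, i.e.
that every `F(z)` is `z ⊛_b F(b_b)` in the enriched sense (`PreservesRegularColimits`).

* A cocontinuous `F` satisfies it by definition. No weighted colimits other than these are needed,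
  in particular no tensors or coequalizers.
* If `F` satisfies it, then maps `t ⟶ D(F(z), Y)` are the `b`-linear families
  `z ⊗ t ⟶ D(F(b_b), Y)`, so that the `C`-functor `D(F(b_b), -)` with values in right `b`-modules is
  right adjoint to `F` (`PreservesRegularColimits.adjunction`).
* A left adjoint is cocontinuous, and preserves tensors and the coequalizers of the underlying
  category, by transposition.
* If `F` preserves tensors and coequalizers, it maps the coequalizer `z ⊙ b ⊙ b_b ⇉ z ⊙ b_b ⟶ z` to
  the one that defines `z ⊛_b F(b_b)`, so `λ` is invertible (`isIso_lambdaApp`); then `- ⊛_b F(b_b)`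
  is enriched because `F` preserves tensors.
* If `- ⊛_b F(b_b)` is enriched, the coequalizers `z ⊛_b F(b_b)` of the underlying category have the
  enriched universal property (`RelTensorIsEnriched.isRelTensor_cq`), and an invertible `λ` carries
  it over to `F(z)`.

If the functors `w ⊙ -` preserve coequalizers, then `w ⊙ (z ⊛_b X)` and `(w ⊙ z) ⊛_b X` are
coequalizers of isomorphic pairs, so that `- ⊛_b X` is enriched.
-/

noncomputable section
namespace EnrichedModules
open ForgetEnrichment

/-! ### Elements of hom objects and isomorphisms -/

section Elements
variable {C : Type u} [Category.{v} C] [MonoidalCategory C]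
  {D : Type u₁} [EnrichedCategory C D] {E : Type u₂} [EnrichedCategory C E]

lemma eMul_id_id (X Y Z : D) : eMul (𝟙 (X ⟶[C] Y)) (𝟙 (Y ⟶[C] Z)) = eComp C X Y Z := by
  simp [eMul]

lemma whiskerRight_eComp {t : C} {X Y Z : D} (g : t ⟶ (X ⟶[C] Y)) :
    g ▷ (Y ⟶[C] Z) ≫ eComp C X Y Z = eMul g (𝟙 (Y ⟶[C] Z)) := by
  simp [eMul]

lemma precomp_eMul {s t : C} {X Y Z W : D} (f : of C X ⟶ of C Y) (g : s ⟶ (Y ⟶[C] Z))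
    (h : t ⟶ (Z ⟶[C] W)) : precomp f (eMul g h) = eMul (precomp f g) h := by
  rw [precomp, precomp, comp_eMul, eMul_assoc, leftUnitor_tensor_inv_assoc]

lemma comp_postcomp_id {t : C} {X Y Z : D} (f : t ⟶ (X ⟶[C] Y)) (g : of C Y ⟶ of C Z) :
    f ≫ postcomp (𝟙 _) g = postcomp f g := by
  rw [← comp_postcomp, Category.comp_id]

lemma comp_precomp_id {t : C} {X Y Z : D} (f : of C X ⟶ of C Y) (g : t ⟶ (Y ⟶[C] Z)) :
    g ≫ precomp f (𝟙 _) = precomp f g := by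
  rw [← comp_precomp, Category.comp_id]

lemma precomp_map (F : EnrichedFunctor C D E) {s : C} {X Y Z : D}
    (f : of C X ⟶ of C Y) (g : s ⟶ (Y ⟶[C] Z)) :
    precomp f g ≫ F.map X Z = precomp (mapHom F f) (g ≫ F.map Y Z) := by
  simp only [precomp, Category.assoc, eMul_map]; rfl

lemma mapHom_comp (F : EnrichedFunctor C D E) {X Y Z : D} (f : of C X ⟶ of C Y)
    (g : of C Y ⟶ of C Z) : mapHom F (f ≫ g) = mapHom F f ≫ mapHom F g :=
  F.forget.map_comp f g

lemma precomp_injective {t : C} {X Y Z : D} (l : of C X ⟶ of C Y) [IsIso l]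
    {f g : t ⟶ (Y ⟶[C] Z)} (h : precomp l f = precomp l g) : f = g := by
  rw [← precomp_id f, ← precomp_id g, ← IsIso.inv_hom_id l, precomp_comp, h, precomp_comp]

lemma EnrichedTrans.isInvertible_of_isIso {F G : EnrichedFunctor C D E} (α : EnrichedTrans F G)
    [∀ X, IsIso (α.app X)] : α.IsInvertible := by
  refine ⟨⟨fun X ↦ inv (α.app X), fun X Y ↦ ?_⟩, fun X ↦ ⟨by simp, by simp⟩⟩
  apply precomp_injective (α.app X)
  rw [precomp_postcomp, ← α.naturality, ← postcomp_comp, IsIso.hom_inv_id, postcomp_id,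
    ← precomp_comp, IsIso.hom_inv_id, precomp_id]

lemma EnrichedTrans.IsInvertible.isIso_app {F G : EnrichedFunctor C D E} {α : EnrichedTrans F G}
    (h : α.IsInvertible) (X : D) : IsIso (α.app X) :=
  let ⟨β, hβ⟩ := h
  ⟨β.app X, hβ X⟩

end Elements

/-! ### Relative tensor products by their universal property -/

section Modules
variable {C : Type u} [Category.{v} C] [MonoidalCategory C] [SymmetricCategory C]
  [MonoidalClosed C] {b : C} [MonObj b]
  {D : Type u₁} [EnrichedCategory C D] [Tensored C D]

lemma LeftModObj.one_rightAdjunct_act (X : LeftModObj b D) :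
    η[b] ≫ rightAdjunct X.act = eId C X.X := by
  have h := congrArg rightAdjunct X.one_act
  rwa [rightAdjunct_tensorHom_comp, precomp_id, tensorUnit, rightAdjunct_leftAdjunct] at h

lemma LeftModObj.eMul_rightAdjunct_act (X : LeftModObj b D) :
    eMul (rightAdjunct X.act) (rightAdjunct X.act) =
      (β_ b b).hom ≫ μ[b] ≫ rightAdjunct X.act := by
  have h := congrArg (fun l ↦ eMul (cv b X.X) (rightAdjunct l)) X.mul_act
  simp only [eMul_cv_rightAdjunct_tensorAssoc_comp, rightAdjunct_tensorHom_comp, precomp_id,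
    Category.id_comp, eMul_precomp] at h
  exact h.symm

/-- The hom object `D(X, Y)` as a right `b`-module, through the left action of `b` on `X`. -/
abbrev homModule (X : LeftModObj b D) (Y : D) : RightMod b where
  X := X.X ⟶[C] Y
  act := (β_ _ b).hom ≫ eMul (rightAdjunct X.act) (𝟙 _)
  act_one := by
    rw [BraidedCategory.braiding_naturality_right_assoc, ← comp_eMul, X.one_rightAdjunct_act,
      eId_eMul]
    simp
  act_mul := by
    have e := eMul_assoc (rightAdjunct X.act) (rightAdjunct X.act) (𝟙 (X.X ⟶[C] Y))
    rw [X.eMul_rightAdjunct_act, ← Iso.inv_comp_eq] at e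
    rw [BraidedCategory.braiding_naturality_right_assoc, ← comp_eMul]
    have e2 := eMul_comp (eMul (rightAdjunct X.act) (𝟙 (X.X ⟶[C] Y)))
      (rightAdjunct X.act) (𝟙 (X.X ⟶[C] Y))
    rw [Category.comp_id] at e2
    rw [comp_whiskerRight_assoc, BraidedCategory.braiding_naturality_left_assoc, ← e2, ← e,
      comp_eMul, comp_eMul, comp_eMul]
    have e3 : (β_ b b).hom ▷ (X.X ⟶[C] Y) ≫ (β_ b b).hom ▷ (X.X ⟶[C] Y) = 𝟙 _ := by
      rw [← comp_whiskerRight, SymmetricCategory.symmetry, id_whiskerRight]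
    simp [BraidedCategory.braiding_tensor_left_hom, BraidedCategory.braiding_tensor_right_hom,
      reassoc_of% e3]

/-- The family `φ : z ⊗ t ⟶ D(X, Y)` equalizes the actions of `b` on `z` and on `X`. -/
def IsBalanced (z : RightMod b) (X : LeftModObj b D) {t : C} {Y : D}
    (φ : z.X ⊗ t ⟶ (X.X ⟶[C] Y)) : Prop :=
  z.act ▷ t ≫ φ = (β_ z.X b).hom ▷ t ≫ (α_ _ _ _).hom ≫ eMul (rightAdjunct X.act) φ

/-- Balanced families are the `b`-linear families with values in `homModule X Y`. -/
lemma isBalanced_iff_isLinear (z : RightMod b) (X : LeftModObj b D) {t : C} {Y : D}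
    (φ : z.X ⊗ t ⟶ (X.X ⟶[C] Y)) :
    IsBalanced z X φ ↔ RightMod.IsLinear z (homModule X Y) φ := by
  have e : swapRight z.X b t ≫ φ ▷ b ≫ (homModule X Y).act =
      (β_ z.X b).hom ▷ t ≫ (α_ _ _ _).hom ≫ eMul (rightAdjunct X.act) φ := by
    have e2 := eMul_comp φ (rightAdjunct X.act) (𝟙 (X.X ⟶[C] Y))
    rw [Category.comp_id] at e2
    rw [BraidedCategory.braiding_naturality_left_assoc, ← e2, ← Category.assoc]
    simp only [← Category.assoc]
    congr 1
    have e0 : z.X ◁ (β_ b t).hom ≫ z.X ◁ (β_ t b).hom = 𝟙 _ := by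
      rw [← MonoidalCategory.whiskerLeft_comp, SymmetricCategory.symmetry,
        MonoidalCategory.whiskerLeft_id]
    simp [swapRight, reassoc_of% e0]
  rw [IsBalanced, RightMod.IsLinear, e]

/-- The universal property of `z ⊛_b X` with respect to elements of hom objects: `P`, together with
`u : z ⟶ D(X, P)`, is the colimit of the left module `X`, seen as a `C`-functor on the one-object
`C`-category `b`, weighted by the right module `z`. -/
structure IsRelTensor (z : RightMod b) (X : LeftModObj b D) {P : D}
    (u : z.X ⟶ (X.X ⟶[C] P)) : Prop where
  isBalanced : IsBalanced z X ((ρ_ z.X).hom ≫ u)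
  existsUnique {t : C} {Y : D} (φ : z.X ⊗ t ⟶ (X.X ⟶[C] Y)) :
    IsBalanced z X φ → ∃! f : t ⟶ (P ⟶[C] Y), eMul u f = φ

/-- The balance condition for the trivial parameter `t = 𝟙_ C`. -/
lemma isBalanced_rightUnitor_comp_iff (z : RightMod b) (X : LeftModObj b D) {P : D}
    (u : z.X ⟶ (X.X ⟶[C] P)) :
    IsBalanced z X ((ρ_ z.X).hom ≫ u) ↔
      (β_ b z.X).hom ≫ z.act ≫ u = eMul (rightAdjunct X.act) u := by
  have e : eMul (rightAdjunct X.act) ((ρ_ z.X).hom ≫ u) = b ◁ (ρ_ z.X).hom ≫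
    eMul (rightAdjunct X.act) u := eMul_comp _ _ _
  rw [IsBalanced, e, ← cancel_epi ((β_ b z.X).hom ≫ (ρ_ _).inv)]
  simp only [Category.assoc, rightUnitor_naturality_assoc, Iso.inv_hom_id_assoc]
  simp


lemma IsRelTensor.hom_ext {z : RightMod b} {X : LeftModObj b D} {P : D}
    {u : z.X ⟶ (X.X ⟶[C] P)} (hu : IsRelTensor z X u) {t : C} {Y : D} {f g : t ⟶ (P ⟶[C] Y)}
    (h : eMul u f = eMul u g) : f = g := by
  have hb : IsBalanced z X (eMul u g) := by
    have h1 := (isBalanced_rightUnitor_comp_iff z X u).1 hu.isBalanced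
    have h2 := eMul_assoc (rightAdjunct X.act) u g
    rw [← Iso.inv_comp_eq] at h2
    rw [IsBalanced, ← h2, ← h1, comp_eMul, comp_eMul]
    simp only [Iso.hom_inv_id_assoc]
    rw [← comp_whiskerRight_assoc, SymmetricCategory.symmetry, id_whiskerRight, Category.id_comp]
  exact (hu.existsUnique _ hb).unique h rfl

lemma IsRelTensor.postcomp {z : RightMod b} {X : LeftModObj b D} {P Q : D}
    {u : z.X ⟶ (X.X ⟶[C] P)} (hu : IsRelTensor z X u) (l : of C P ⟶ of C Q) [IsIso l] :
    IsRelTensor z X (postcomp u l) where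
  isBalanced := by
    have h1 := (isBalanced_rightUnitor_comp_iff z X u).1 hu.isBalanced
    rw [isBalanced_rightUnitor_comp_iff, eMul_postcomp, ← h1, ← comp_postcomp, ← comp_postcomp]
  existsUnique φ hφ := by
    obtain ⟨f, hf, -⟩ := hu.existsUnique φ hφ
    refine ⟨precomp (inv l) f, ?_, fun g hg ↦ ?_⟩
    · dsimp only
      rw [← eMul_precomp, ← precomp_comp, IsIso.hom_inv_id, precomp_id, hf]
    · apply precomp_injective l
      apply hu.hom_ext
      rw [eMul_precomp, hg, ← precomp_comp, IsIso.hom_inv_id, precomp_id, hf]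

/-- The coequalizer `z ⊛_b X` of the underlying category has the universal property for elements of
all shapes `t` if `- ⊛_b X` is enriched: a balanced family `z ⊗ t ⟶ D(X, Y)` is the same as a
morphism `(t ⊙ z) ⊛_b X ⟶ Y`, hence as a morphism `t ⊙ (z ⊛_b X) ⟶ Y`. -/
lemma RelTensorIsEnriched.isRelTensor_cq [HasCoequalizers (ForgetEnrichment C D)]
    [HasEqualizers C] {X : LeftModObj b D} (h : RelTensorIsEnriched X) (z : RightMod b) :
    IsRelTensor z X (rightAdjunct (cq z X)) where
  isBalanced := by
    rw [isBalanced_rightUnitor_comp_iff, ← relLeft_eq_relRight_iff, relLeft_cq]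
  existsUnique {t Y} φ hφ := by
    have hk : relLeft (t ⊙ z) X ≫ leftAdjunct ((β_ t z.X).hom ≫ φ) =
        relRight (t ⊙ z) X ≫ leftAdjunct ((β_ t z.X).hom ≫ φ) := by
      rw [relLeft_eq_relRight_iff, rightAdjunct_leftAdjunct, eMul_comp]
      rw [IsBalanced] at hφ
      change (β_ b (t ⊗ z.X)).hom ≫ ((α_ t z.X b).hom ≫ t ◁ z.act) ≫ _ = _
      simp only [Category.assoc]
      rw [BraidedCategory.braiding_naturality_right_assoc, hφ]
      have e3 : (α_ t z.X b).hom ≫ (β_ t (z.X ⊗ b)).hom ≫ (β_ z.X b).hom ▷ t ≫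
          (α_ b z.X t).hom = (β_ t z.X).hom ▷ b ≫ (β_ (z.X ⊗ t) b).hom := by
        simp [BraidedCategory.braiding_tensor_left_hom, BraidedCategory.braiding_tensor_right_hom]
      rw [reassoc_of% e3, ← BraidedCategory.braiding_naturality_right_assoc,
        SymmetricCategory.symmetry_assoc]
    refine ⟨rightAdjunct ((h.assoc t z).hom ≫ relDesc _ hk), ?_, fun g hg ↦ ?_⟩
    · dsimp only
      rw [h.eMul_cq_rightAdjunct, Iso.inv_hom_id_assoc, cq_relDesc, rightAdjunct_leftAdjunct,
        SymmetricCategory.symmetry_assoc]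
    · apply h.eMul_cq_injective
      rw [hg, h.eMul_cq_rightAdjunct, Iso.inv_hom_id_assoc, cq_relDesc, rightAdjunct_leftAdjunct,
        SymmetricCategory.symmetry_assoc]

end Modules

section Density
variable {C : Type u} [Category.{v} C] [MonoidalCategory C] [SymmetricCategory C]
  [MonoidalClosed C] [HasEqualizers C] {b : C} [MonObj b]

/-! ### Every module is a weighted colimit of the regular module -/

namespace RightMod

/-- Evaluation of module maps `b_b ⟶ y` at the unit of `b`. -/
def evOne (y : RightMod b) : (regular b ⟶[C] y) ⟶ y.X :=
  (λ_ _).inv ≫ η[b] ▷ _ ≫ homEv (regular b) y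

lemma rightAdjunct_actHom_evOne (y : RightMod b) :
    rightAdjunct (actHom y) ≫ evOne y = 𝟙 _ := by
  have h := whiskerLeft_rightAdjunct_actHom_homEv y
  dsimp only [regular] at h
  rw [evOne, leftUnitor_inv_naturality_assoc, whisker_exchange_assoc]
  dsimp only [regular]
  rw [h, BraidedCategory.braiding_naturality_left_assoc, y.act_one]
  simp

/-- A module map on `b_b` is determined by its value at the unit, by `b`-linearity. -/
lemma evOne_rightAdjunct_actHom (y : RightMod b) :
    evOne y ≫ rightAdjunct (actHom y) = 𝟙 _ := by
  apply hom_ext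
  have h := whiskerLeft_rightAdjunct_actHom_homEv y
  have h2 := isLinear_homEv (regular b) y
  have e : b ◁ evOne y ≫ (β_ b y.X).hom = b ◁ ((λ_ _).inv ≫ η[b] ▷ _) ≫ (β_ b _).hom ≫
      homEv (regular b) y ▷ b := by
    rw [evOne, ← Category.assoc, MonoidalCategory.whiskerLeft_comp, Category.assoc,
      BraidedCategory.braiding_naturality_right]
  rw [IsLinear] at h2
  dsimp only [regular] at h h2 e ⊢
  rw [MonoidalCategory.whiskerLeft_comp, Category.assoc, h, reassoc_of% e]
  have e2 : (β_ b (b ⊗ (regular b ⟶[C] y))).hom =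
      (α_ _ _ _).inv ≫ (β_ b b).hom ▷ _ ≫ swapRight b b (regular b ⟶[C] y) := by
    simp [swapRight, BraidedCategory.braiding_tensor_right_hom]
  dsimp only [regular] at e2
  rw [e2]
  simp only [Category.assoc]
  rw [← h2]
  have e3 : ∀ H : C, b ◁ ((λ_ H).inv ≫ η[b] ▷ H) ≫ (α_ b b H).inv ≫ (β_ b b).hom ▷ H ≫
      μ[b] ▷ H = 𝟙 _ := fun H ↦ by
    have e4 : b ◁ η[b] ≫ (β_ b b).hom ≫ μ[b] = (ρ_ b).hom := by
      rw [BraidedCategory.braiding_naturality_right_assoc, MonObj.one_mul]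
      simp
    rw [MonoidalCategory.whiskerLeft_comp, Category.assoc, associator_inv_naturality_middle_assoc,
      ← comp_whiskerRight, ← comp_whiskerRight, e4]
    simp
  rw [reassoc_of% (e3 (regular b ⟶[C] y)), MonoidalCategory.whiskerLeft_id, Category.id_comp]

lemma isIso_rightAdjunct_actHom (y : RightMod b) : IsIso (rightAdjunct (actHom y)) :=
  ⟨evOne y, rightAdjunct_actHom_evOne y, evOne_rightAdjunct_actHom y⟩

variable (b) in
/-- The monoid `b` as a left module object in the category of right `b`-modules. -/
abbrev regularObj : LeftModObj b (RightMod b) where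
  X := regular b
  act := actHom (regular b)
  one_act := by
    apply rightAdjunct_injective
    rw [rightAdjunct_tensorHom_comp, precomp_id, tensorUnit, rightAdjunct_leftAdjunct,
      one_rightAdjunct_actHom]
  mul_act := by
    apply rightAdjunct_injective
    apply eMul_cv_injective
    rw [eMul_cv_rightAdjunct_tensorAssoc_comp, rightAdjunct_tensorHom_comp, precomp_id,
      rightAdjunct_tensorHom_comp, Category.id_comp, eMul_precomp]
    exact (eMul_rightAdjunct_actHom_actHom (regular b)).symm

/-- Every module `z` is the relative tensor product `z ⊛_b b_b`, because `Mod(b_b, y) ≅ y`. -/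
lemma isRelTensor_actHom (z : RightMod b) :
    IsRelTensor z (regularObj b) (rightAdjunct (actHom z)) where
  isBalanced := (isBalanced_rightUnitor_comp_iff _ _ _).2 (eMul_rightAdjunct_actHom_actHom z).symm
  existsUnique {t y} φ hφ := by
    have := isIso_rightAdjunct_actHom y
    have hl : IsLinear z y (φ ≫ evOne y) := by
      rw [isBalanced_iff_isLinear] at hφ
      have e : evOne y ▷ b ≫ y.act ≫ rightAdjunct (actHom y) =
          (homModule (regularObj b) y).act := by
        have h := eMul_rightAdjunct_actHom_actHom y
        rw [← cancel_epi (β_ b _).hom, ← BraidedCategory.braiding_naturality_right_assoc, ← h,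
          ← eMul_comp, evOne_rightAdjunct_actHom, SymmetricCategory.symmetry_assoc]
      rw [IsLinear, ← cancel_mono (rightAdjunct (actHom y))]
      simp only [Category.assoc, comp_whiskerRight]
      rw [evOne_rightAdjunct_actHom, Category.comp_id, hφ, e]
    refine ⟨homMk z y _ hl, ?_, fun g hg ↦ ?_⟩
    · dsimp only
      rw [eMul_rightAdjunct_actHom, whiskerLeft_homMk_homEv, Category.assoc,
        evOne_rightAdjunct_actHom, Category.comp_id]
    · apply hom_ext
      rw [whiskerLeft_homMk_homEv, ← cancel_mono (rightAdjunct (actHom y)),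
        ← eMul_rightAdjunct_actHom, hg, Category.assoc, evOne_rightAdjunct_actHom,
        Category.comp_id]

end RightMod

variable {D : Type u₁} [EnrichedCategory C D] [Tensored C D]

lemma rightAdjunct_act_evalRegular (F : EnrichedFunctor C (RightMod b) D) :
    rightAdjunct (evalRegular F).act =
      rightAdjunct (RightMod.actHom (RightMod.regular b)) ≫ F.map _ _ :=
  rightAdjunct_strength_comp_map _ _

/-- The map `z ⟶ D(F(b_b), F(z))` which `F` induces from the adjunct `z ⟶ Mod(b_b, z)` of the
action. -/
def actMap (F : EnrichedFunctor C (RightMod b) D) (z : RightMod b) :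
    z.X ⟶ ((evalRegular F).X ⟶[C] F.obj z) :=
  rightAdjunct (RightMod.actHom z) ≫ F.map (RightMod.regular b) z

section actMap
variable (F : EnrichedFunctor C (RightMod b) D)

lemma eMul_act_actMap (z : RightMod b) :
    eMul (rightAdjunct (evalRegular F).act) (actMap F z) =
      (β_ b z.X).hom ≫ z.act ≫ actMap F z := by
  rw [rightAdjunct_act_evalRegular]
  refine (eMul_map F _ _).symm.trans ?_
  rw [RightMod.eMul_rightAdjunct_actHom_actHom]
  simp only [actMap, Category.assoc]
  rfl

lemma eMul_actMap {t : C} {z y : RightMod b} (f : t ⟶ (z ⟶[C] y)) :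
    eMul (actMap F z) (f ≫ F.map z y) = (z.X ◁ f ≫ RightMod.homEv z y) ≫ actMap F y := by
  refine (eMul_map F _ _).symm.trans ?_
  rw [RightMod.eMul_rightAdjunct_actHom, Category.assoc]
  rfl

lemma postcomp_actMap {z y : RightMod b} (l : of C z ⟶ of C y) :
    postcomp (actMap F z) (mapHom F l) = RightMod.underlying l ≫ actMap F y := by
  have h := eMul_actMap F (toHom l)
  rw [postcomp]
  refine (congrArg ((ρ_ z.X).inv ≫ ·) h).trans ?_
  simp [RightMod.underlying]

lemma postcomp_cq_lambdaApp_eq_actMap [HasCoequalizers (ForgetEnrichment C D)] (z : RightMod b) :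
    postcomp (rightAdjunct (cq z (evalRegular F))) (lambdaApp F z) = actMap F z :=
  postcomp_cq_lambdaApp F z

end actMap

/-- Every `F(z)` is the relative tensor product of `z` with `F(b_b)`. Since `z` is the relative
tensor product of `z` with `b_b`, this says that `F` preserves this particular weighted colimit. -/
def PreservesRegularColimits (F : EnrichedFunctor C (RightMod b) D) : Prop :=
  ∀ z : RightMod b, IsRelTensor z (evalRegular F) (actMap F z)

/-! ### Preservation of weighted colimits -/

/-- The object type of the `C`-category with one object and endomorphism object `b`. -/
def Deloop (_b : C) : Type w := PUnit.{w + 1}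

/-- The braiding in the composition accounts for the diagrammatic order of composition: with it,
left modules over `b` are `C`-functors on `Deloop b`, and right modules are weights. -/
instance : EnrichedCategory C (Deloop.{w} b) where
  Hom _ _ := b
  id _ := η[b]
  comp _ _ _ := (β_ b b).hom ≫ μ[b]
  id_comp _ _ := by simp
  comp_id _ _ := by simp
  assoc _ _ _ _ := by
    simp [BraidedCategory.yang_baxter_assoc]

/-- A right module as a weight on the one-object `C`-category `b`. -/
def RightMod.weight (z : RightMod b) : EnrichedFunctor C (Deloop.{w} b)ᵒᵖ C where
  obj _ := z.X
  map _ _ := curry z.act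
  map_id _ := by
    change η[b] ≫ curry z.act = MonoidalClosed.id z.X
    rw [MonoidalClosed.id_eq, ← curry_natural_left, z.act_one]
  map_comp _ _ _ := by
    change ((β_ b b).hom ≫ (β_ b b).hom ≫ μ[b]) ≫ curry z.act =
      (curry z.act ⊗ₘ curry z.act) ≫ MonoidalClosed.comp z.X z.X z.X
    rw [MonoidalClosed.comp_eq, SymmetricCategory.symmetry_assoc, ← curry_natural_left, z.act_mul,
      ← curry_natural_left]
    congr 1
    rw [MonoidalClosed.compTranspose_eq, MonoidalCategory.tensorHom_def]
    simp only [MonoidalCategory.whiskerLeft_comp, Category.assoc]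
    rw [associator_inv_naturality_right_assoc, whisker_exchange_assoc,
      associator_inv_naturality_middle_assoc, ← comp_whiskerRight_assoc,
      whiskerLeft_curry_ihom_ev_app]
    dsimp only [Functor.id_obj]
    rw [whiskerLeft_curry_ihom_ev_app]

/-- A left module object as a `C`-functor on the one-object `C`-category `b`. -/
def LeftModObj.diagram (X : LeftModObj b D) : EnrichedFunctor C (Deloop.{w} b) D where
  obj _ := X.X
  map _ _ := rightAdjunct X.act
  map_id _ := X.one_rightAdjunct_act
  map_comp _ _ _ := (Category.assoc _ _ _).trans X.eMul_rightAdjunct_act.symm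

lemma regularObj_diagram_comp (F : EnrichedFunctor C (RightMod b) D) :
    (RightMod.regularObj b).diagram.comp C F = (evalRegular F).diagram :=
  EnrichedFunctor.ext (h_obj := fun _ ↦ rfl) (h_map := fun _ _ ↦
    (Category.comp_id _).trans (rightAdjunct_act_evalRegular F).symm)

omit [HasEqualizers C] in
lemma isWeightedFamily_iff_isBalanced (z : RightMod b) {X : LeftModObj b D} {t : C} {Y : D}
    (φ : z.X ⊗ t ⟶ (X.X ⟶[C] Y)) :
    IsWeightedFamily z.weight.{w} X.diagram (fun _ ↦ φ) ↔ IsBalanced z X φ := by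
  have e (j k : Deloop.{w} b) : weightAct z.weight j k = z.act := uncurry_curry _
  simp only [IsWeightedFamily, e]
  exact ⟨fun h ↦ h PUnit.unit PUnit.unit, fun h _ _ ↦ h⟩

omit [HasEqualizers C] in
lemma isWeightedColimit_iff_isRelTensor {z : RightMod b} {X : LeftModObj b D} {P : D}
    (u : z.X ⟶ (X.X ⟶[C] P)) :
    IsWeightedColimit z.weight.{w} X.diagram P (fun _ ↦ u) ↔ IsRelTensor z X u := by
  refine ⟨fun h ↦ ⟨(isWeightedFamily_iff_isBalanced z _).1 h.isFamily, fun {t Y} φ hφ ↦ ?_⟩,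
    fun h ↦ ⟨(isWeightedFamily_iff_isBalanced z _).2 h.isBalanced, fun t Y φ hφ ↦ ?_⟩⟩
  · obtain ⟨f, hf, hf'⟩ := h.existsUnique t Y (fun _ ↦ φ)
      ((isWeightedFamily_iff_isBalanced z φ).2 hφ)
    exact ⟨f, hf PUnit.unit, fun g hg ↦ hf' g fun _ ↦ hg⟩
  · obtain ⟨f, hf, hf'⟩ := h.existsUnique _
      ((isWeightedFamily_iff_isBalanced z (φ PUnit.unit)).1 hφ)
    exact ⟨f, fun _ ↦ hf, fun g hg ↦ hf' g (hg PUnit.unit)⟩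

omit [HasEqualizers C] in
/-- A version of `isWeightedColimit_iff_isRelTensor` for a diagram `G` that is only propositionally
equal to `X.diagram`, as for `regularObj_diagram_comp`. -/
lemma IsWeightedColimit.isRelTensor {z : RightMod b} {X : LeftModObj b D} {P : D}
    {G : EnrichedFunctor C (Deloop.{w} b) D} {ω : ∀ j, z.weight.obj (op j) ⟶ (G.obj j ⟶[C] P)}
    (h : IsWeightedColimit z.weight G P ω) (hG : G = X.diagram) {u : z.X ⟶ (X.X ⟶[C] P)}
    (hω : HEq ω fun _ : Deloop.{w} b ↦ u) : IsRelTensor z X u := by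
  subst hG
  obtain rfl := eq_of_heq hω
  exact (isWeightedColimit_iff_isRelTensor u).1 h

/-- `F` preserves the weighted colimit that presents `z` as `z ⊛_b b_b`. -/
lemma IsEnrichedCocontinuous.preservesRegularColimits {F : EnrichedFunctor C (RightMod b) D}
    (hF : IsEnrichedCocontinuous.{w} F) : PreservesRegularColimits F := fun z ↦
  (hF _ _ _ _ _ ((isWeightedColimit_iff_isRelTensor.{w} _).2
    (RightMod.isRelTensor_actHom z))).isRelTensor (regularObj_diagram_comp F) HEq.rfl

end Density

/-! ### The right adjoint -/

section RightAdjoint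
variable {C : Type u} [Category.{v} C] [MonoidalCategory C] [SymmetricCategory C]
  [MonoidalClosed C] [HasEqualizers C] {b : C} [MonObj b]
  {D : Type u₁} [EnrichedCategory C D] [Tensored C D]

lemma RightMod.whiskerLeft_precomp_homEv {t : C} {x y z : RightMod b} (l : of C x ⟶ of C y)
    (g : t ⟶ (y ⟶[C] z)) :
    x.X ◁ precomp l g ≫ homEv x z = underlying l ▷ t ≫ y.X ◁ g ≫ homEv y z := by
  rw [precomp, MonoidalCategory.whiskerLeft_comp, Category.assoc, whiskerLeft_eMul_homEv,
    underlying]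
  simp

lemma RightMod.underlying_injective {x y : RightMod b} {f g : of C x ⟶ of C y}
    (h : underlying f = underlying g) : f = g :=
  RightMod.hom_ext ((cancel_epi (ρ_ x.X).inv).1 h)

lemma RightMod.underlying_id (x : RightMod b) : underlying (𝟙 (of C x)) = 𝟙 x.X := by
  rw [underlying, toHom_id, whiskerLeft_eId_homEv, Iso.inv_hom_id]

lemma RightMod.underlying_comp {x y z : RightMod b} (f : of C x ⟶ of C y) (g : of C y ⟶ of C z) :
    underlying (f ≫ g) = underlying f ≫ underlying g := by
  have h := whiskerLeft_postcomp_homEv (toHom f) g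
  rw [underlying, underlying, Category.assoc, Category.assoc, ← h, toHom_comp, postcomp,
    unitors_inv_equal]

omit [HasEqualizers C] in
lemma isLinear_eComp_homModule (X : LeftModObj b D) (Y Z : D) :
    RightMod.IsLinear (homModule X Y) (homModule X Z) (eComp C X.X Y Z) := by
  rw [← isBalanced_iff_isLinear, IsBalanced]
  dsimp only [homModule]
  have e := eMul_assoc (rightAdjunct X.act) (𝟙 (X.X ⟶[C] Y)) (𝟙 (Y ⟶[C] Z))
  rw [comp_whiskerRight, Category.assoc, whiskerRight_eComp, e, eMul_id_id]

/-- The `C`-functor `D(X, -)` from `D` to right `b`-modules. -/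
abbrev homModuleFunctor (X : LeftModObj b D) : EnrichedFunctor C D (RightMod b) where
  obj Y := homModule X Y
  map Y Z := RightMod.homMk _ _ _ (isLinear_eComp_homModule X Y Z)
  map_id Y := by
    apply RightMod.hom_ext
    rw [MonoidalCategory.whiskerLeft_comp, Category.assoc, RightMod.whiskerLeft_homMk_homEv,
      RightMod.whiskerLeft_eId_homEv, ← Iso.inv_comp_eq_id]
    exact e_comp_id C X.X Y
  map_comp Y Z W := by
    apply RightMod.hom_ext
    have h := RightMod.whiskerLeft_eMul_homEv
      (RightMod.homMk _ _ _ (isLinear_eComp_homModule X Y Z))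
      (RightMod.homMk _ _ _ (isLinear_eComp_homModule X Z W))
    refine Eq.trans ?_ h.symm
    rw [MonoidalCategory.whiskerLeft_comp, Category.assoc, RightMod.whiskerLeft_homMk_homEv,
      RightMod.whiskerLeft_homMk_homEv, RightMod.whiskerLeft_homMk_homEv]
    exact (e_assoc C X.X Y Z W).symm

variable (F : EnrichedFunctor C (RightMod b) D)

/-- The unit `z ⟶ D(F(b_b), F(z))` of the adjunction. -/
def homModuleUnit (z : RightMod b) : of C z ⟶ of C (homModule (evalRegular F) (F.obj z)) :=
  RightMod.ofLinear (y := homModule (evalRegular F) (F.obj z)) (actMap F z) (by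
    rw [BraidedCategory.braiding_naturality_left_assoc, ← eMul_comp, Category.comp_id,
      eMul_act_actMap, SymmetricCategory.symmetry_assoc])

lemma underlying_homModuleUnit (z : RightMod b) :
    RightMod.underlying (homModuleUnit F z) = actMap F z :=
  RightMod.underlying_ofLinear _ _

lemma homModuleUnit_naturality (z y : RightMod b) :
    postcomp (𝟙 (z ⟶[C] y)) (homModuleUnit F y) =
      precomp (homModuleUnit F z) (F.map z y ≫ RightMod.homMk _ _ _
        (isLinear_eComp_homModule (evalRegular F) (F.obj z) (F.obj y))) := by
  apply RightMod.hom_ext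
  have h := eMul_actMap F (𝟙 (z ⟶[C] y))
  rw [Category.id_comp, MonoidalCategory.whiskerLeft_id, Category.id_comp] at h
  rw [RightMod.whiskerLeft_postcomp_homEv, RightMod.whiskerLeft_precomp_homEv,
    underlying_homModuleUnit, underlying_homModuleUnit, MonoidalCategory.whiskerLeft_id,
    Category.id_comp, ← h, MonoidalCategory.whiskerLeft_comp, Category.assoc,
    RightMod.whiskerLeft_homMk_homEv, eMul, MonoidalCategory.tensorHom_def,
    Category.assoc]

namespace PreservesRegularColimits
variable {F}

lemma exists_counit (hF : PreservesRegularColimits F) (Y : D) :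
    ∃ l : of C (F.obj (homModule (evalRegular F) Y)) ⟶ of C Y,
      postcomp (actMap F (homModule (evalRegular F) Y)) l = 𝟙 ((evalRegular F).X ⟶[C] Y) := by
  obtain ⟨f, hf, -⟩ := (hF (homModule (evalRegular F) Y)).existsUnique _
    ((isBalanced_iff_isLinear _ _ _).2 (RightMod.isLinear_id _))
  exact ⟨ofHom f, (Iso.inv_comp_eq_id _).2 hf⟩

/-- The counit `F(D(F(b_b), Y)) ⟶ Y` of the adjunction, which corresponds to the identity of
`D(F(b_b), Y)`. -/
def counit (hF : PreservesRegularColimits F) (Y : D) :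
    of C (F.obj (homModule (evalRegular F) Y)) ⟶ of C Y :=
  (hF.exists_counit Y).choose

lemma postcomp_counit (hF : PreservesRegularColimits F) (Y : D) :
    postcomp (actMap F (homModule (evalRegular F) Y)) (hF.counit Y) =
      𝟙 ((evalRegular F).X ⟶[C] Y) :=
  (hF.exists_counit Y).choose_spec

/-- Morphisms out of `F(z)` are determined by their composites with `F(b_b) ⟶ F(z)`, in the sense of
generalized elements. -/
lemma hom_ext (hF : PreservesRegularColimits F) {z : RightMod b} {Y : D}
    {f g : of C (F.obj z) ⟶ of C Y}
    (h : postcomp (actMap F z) f = postcomp (actMap F z) g) : f = g := by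
  have h2 : eMul (actMap F z) (toHom f) = eMul (actMap F z) (toHom g) := by
    simpa only [postcomp, Iso.cancel_iso_inv_left] using h
  exact (hF z).hom_ext h2

lemma counit_naturality (hF : PreservesRegularColimits F) (Y Z : D) :
    postcomp (RightMod.homMk _ _ _ (isLinear_eComp_homModule (evalRegular F) Y Z) ≫ F.map _ _)
      (hF.counit Z) = precomp (hF.counit Y) (𝟙 (Y ⟶[C] Z)) := by
  apply (hF (homModule (evalRegular F) Y)).hom_ext
  rw [eMul_postcomp, eMul_precomp, postcomp_counit, eMul_actMap, comp_postcomp, postcomp_counit,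
    RightMod.whiskerLeft_homMk_homEv, eMul_id_id, Category.comp_id]

lemma mapHom_unit_counit (hF : PreservesRegularColimits F) (z : RightMod b) :
    mapHom F (homModuleUnit F z) ≫ hF.counit (F.obj z) = 𝟙 (of C (F.obj z)) := by
  apply hF.hom_ext
  rw [postcomp_comp, postcomp_actMap, underlying_homModuleUnit, comp_postcomp, postcomp_id,
    postcomp_counit, Category.comp_id]

lemma unit_mapHom_counit (hF : PreservesRegularColimits F) (Y : D) :
    homModuleUnit F (homModule (evalRegular F) Y) ≫
      mapHom (homModuleFunctor (evalRegular F)) (hF.counit Y) = 𝟙 (of C _) := by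
  apply RightMod.underlying_injective
  have h : RightMod.underlying (mapHom (homModuleFunctor (evalRegular F)) (hF.counit Y)) =
      postcomp (𝟙 _) (hF.counit Y) := by
    change (ρ_ _).inv ≫ _ ◁ (toHom (hF.counit Y) ≫ RightMod.homMk _ _ _
      (isLinear_eComp_homModule _ _ _)) ≫ RightMod.homEv _ _ = _
    rw [MonoidalCategory.whiskerLeft_comp, Category.assoc, RightMod.whiskerLeft_homMk_homEv,
      postcomp, eMul]
    simp
  rw [RightMod.underlying_comp, RightMod.underlying_id, h, underlying_homModuleUnit,
    comp_postcomp_id, postcomp_counit]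

/-- The adjunction between `F` and `D(F(b_b), -)`. -/
def adjunction (hF : PreservesRegularColimits F) :
    EnrichedAdjunction F (homModuleFunctor (evalRegular F)) where
  unit := ⟨homModuleUnit F, homModuleUnit_naturality F⟩
  counit := ⟨hF.counit, hF.counit_naturality⟩
  left_triangle := hF.mapHom_unit_counit
  right_triangle := hF.unit_mapHom_counit

end PreservesRegularColimits
end RightAdjoint

/-! ### Enriched left adjoints -/

section LeftAdjoints
variable {C : Type u} [Category.{v} C] [MonoidalCategory C]
  {D : Type u₁} [EnrichedCategory C D] {E : Type u₂} [EnrichedCategory C E]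

lemma postcomp_toHom {X Y Z : D} (f : of C X ⟶ of C Y) (g : of C Y ⟶ of C Z) :
    postcomp (toHom f) g = toHom (f ≫ g) := by
  rw [postcomp, toHom_comp, unitors_inv_equal]

lemma precomp_toHom {X Y Z : D} (f : of C X ⟶ of C Y) (g : of C Y ⟶ of C Z) :
    precomp f (toHom g) = toHom (f ≫ g) := by
  rw [precomp, toHom_comp]

namespace EnrichedAdjunction
variable {F : EnrichedFunctor C D E} {G : EnrichedFunctor C E D} (adj : EnrichedAdjunction F G)

/-- The component `X ⟶ G (F X)` of the unit. -/
def unitApp (X : D) : of C X ⟶ of C (G.obj (F.obj X)) := adj.unit.app X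

/-- The component `F (G Y) ⟶ Y` of the counit. -/
def counitApp (Y : E) : of C (F.obj (G.obj Y)) ⟶ of C Y := adj.counit.app Y

lemma postcomp_unitApp {t : C} {X Y : D} (f : t ⟶ (X ⟶[C] Y)) :
    postcomp f (adj.unitApp Y) = precomp (adj.unitApp X) (f ≫ F.map X Y ≫ G.map _ _) := by
  rw [← comp_postcomp_id, comp_precomp]
  exact congrArg (f ≫ ·) (adj.unit.naturality X Y)

lemma postcomp_counitApp {t : C} {X Y : E} (f : t ⟶ (X ⟶[C] Y)) :
    postcomp (f ≫ G.map X Y ≫ F.map _ _) (adj.counitApp Y) = precomp (adj.counitApp X) f := by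
  rw [← comp_precomp_id, comp_postcomp]
  exact congrArg (f ≫ ·) (adj.counit.naturality X Y)

lemma comp_unitApp {X Y : D} (f : of C X ⟶ of C Y) :
    f ≫ adj.unitApp Y = adj.unitApp X ≫ mapHom G (mapHom F f) := by
  have h := adj.postcomp_unitApp (toHom f)
  have e : toHom f ≫ F.map X Y ≫ G.map _ _ = toHom (mapHom G (mapHom F f)) :=
    (Category.assoc _ _ _).symm
  rw [postcomp_toHom, e, precomp_toHom] at h
  exact h

lemma mapHom_mapHom_counitApp {X Y : E} (f : of C X ⟶ of C Y) :
    mapHom F (mapHom G f) ≫ adj.counitApp Y = adj.counitApp X ≫ f := by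
  have h := adj.postcomp_counitApp (toHom f)
  have e : toHom f ≫ G.map X Y ≫ F.map _ _ = toHom (mapHom F (mapHom G f)) :=
    (Category.assoc _ _ _).symm
  rw [precomp_toHom, e, postcomp_toHom] at h
  exact h

lemma mapHom_unitApp_counitApp (X : D) :
    mapHom F (adj.unitApp X) ≫ adj.counitApp (F.obj X) = 𝟙 (of C (F.obj X)) :=
  adj.left_triangle X

lemma unitApp_mapHom_counitApp (Y : E) :
    adj.unitApp (G.obj Y) ≫ mapHom G (adj.counitApp Y) = 𝟙 (of C (G.obj Y)) :=
  adj.right_triangle Y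

/-- The transpose `t ⟶ D(X, G Y)` of an element `t ⟶ E(F X, Y)`. -/
def transpose {t : C} {X : D} {Y : E} (f : t ⟶ (F.obj X ⟶[C] Y)) : t ⟶ (X ⟶[C] G.obj Y) :=
  precomp (adj.unitApp X) (f ≫ G.map _ _)

/-- The element `t ⟶ E(F X, Y)` with a given transpose `t ⟶ D(X, G Y)`. -/
def untranspose {t : C} {X : D} {Y : E} (g : t ⟶ (X ⟶[C] G.obj Y)) : t ⟶ (F.obj X ⟶[C] Y) :=
  postcomp (g ≫ F.map _ _) (adj.counitApp Y)

lemma untranspose_transpose {t : C} {X : D} {Y : E} (f : t ⟶ (F.obj X ⟶[C] Y)) :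
    adj.untranspose (adj.transpose f) = f := by
  rw [untranspose, transpose, precomp_map, ← precomp_postcomp, Category.assoc, postcomp_counitApp,
    ← precomp_comp, mapHom_unitApp_counitApp, precomp_id]

lemma transpose_untranspose {t : C} {X : D} {Y : E} (g : t ⟶ (X ⟶[C] G.obj Y)) :
    adj.transpose (adj.untranspose g) = g := by
  rw [untranspose, transpose, postcomp_map, precomp_postcomp, Category.assoc, ← postcomp_unitApp,
    ← postcomp_comp, unitApp_mapHom_counitApp, postcomp_id]

lemma transpose_injective {t : C} {X : D} {Y : E} {f g : t ⟶ (F.obj X ⟶[C] Y)}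
    (h : adj.transpose f = adj.transpose g) : f = g := by
  rw [← adj.untranspose_transpose f, h, untranspose_transpose]

lemma comp_transpose {s t : C} {X : D} {Y : E} (p : s ⟶ t) (f : t ⟶ (F.obj X ⟶[C] Y)) :
    adj.transpose (p ≫ f) = p ≫ adj.transpose f := by
  rw [transpose, Category.assoc, comp_precomp, transpose]

lemma transpose_eMul {s t : C} {X X' : D} {Y : E} (p : s ⟶ (X ⟶[C] X'))
    (f : t ⟶ (F.obj X' ⟶[C] Y)) :
    adj.transpose (eMul (p ≫ F.map X X') f) = eMul p (adj.transpose f) := by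
  rw [transpose, transpose, eMul_map, eMul_precomp, postcomp_unitApp, precomp_eMul, Category.assoc]

lemma transpose_postcomp {t : C} {X : D} {Y Z : E} (f : t ⟶ (F.obj X ⟶[C] Y))
    (g : of C Y ⟶ of C Z) : adj.transpose (postcomp f g) =
      postcomp (adj.transpose f) (mapHom G g) := by
  rw [transpose, postcomp_map, precomp_postcomp, transpose]

/-- The adjunction of the underlying functors. -/
def forgetAdjunction : F.forget ⊣ G.forget :=
  Adjunction.mkOfUnitCounit
    { unit := { app := adj.unitApp, naturality := fun _ _ f ↦ adj.comp_unitApp f }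
      counit := { app := adj.counitApp, naturality := fun _ _ f ↦ adj.mapHom_mapHom_counitApp f }
      left_triangle := by
        ext X
        exact (congrArg (_ ≫ ·) (Category.id_comp _)).trans (adj.mapHom_unitApp_counitApp X)
      right_triangle := by
        ext Y
        exact (congrArg (_ ≫ ·) (Category.id_comp _)).trans (adj.unitApp_mapHom_counitApp Y) }

section Weighted
open scoped MonoidalClosed
variable [SymmetricCategory C] [MonoidalClosed C]

include adj in
/-- Weighted families on `E(F H -, Y)` and on `D(H -, G Y)` correspond by transposition. -/
lemma isEnrichedCocontinuous : IsEnrichedCocontinuous.{w} F := by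
  intro J _ W H L ω hω
  refine ⟨fun j k ↦ ?_, fun t Y φ hφ ↦ ?_⟩
  · have h := congrArg (· ≫ F.map _ _) (hω.isFamily j k)
    simp only [Category.assoc, eMul_map] at h ⊢
    exact h
  · obtain ⟨f, hf, hf'⟩ := hω.existsUnique t (G.obj Y) (fun j ↦ adj.transpose (φ j)) (fun j k ↦ by
      refine (adj.comp_transpose _ _).symm.trans ((congrArg adj.transpose (hφ j k)).trans ?_)
      exact (adj.comp_transpose _ _).trans (congrArg (_ ≫ ·)
        ((adj.comp_transpose _ _).trans (congrArg (_ ≫ ·) (adj.transpose_eMul _ _)))))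
    refine ⟨adj.untranspose f, fun j ↦ ?_, fun g hg ↦ ?_⟩
    · apply adj.transpose_injective
      refine (adj.transpose_eMul _ _).trans ?_
      rw [transpose_untranspose, hf]
    · rw [← hf' (adj.transpose g) fun j ↦ ?_, untranspose_transpose]
      rw [← hg j]
      exact (adj.transpose_eMul _ _).symm

end Weighted

variable [MonoidalClosed C] [Tensored C D] [Tensored C E]

include adj in
/-- The inverse of the strength is the transpose of `z ⊙ X ⟶ G (z ⊙ F X)`, whose adjunct in turn is
the transpose of `z ⟶ E(F X, z ⊙ F X)`. -/
lemma preservesTensors : PreservesTensors F := by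
  intro z X
  let l : of C (z ⊙ X) ⟶ of C (G.obj (z ⊙ F.obj X)) := leftAdjunct (adj.transpose (cv z (F.obj X)))
  refine ⟨mapHom F l ≫ adj.counitApp _, ?_, ?_⟩
  · apply rightAdjunct_injective
    rw [← Category.assoc, rightAdjunct_comp, rightAdjunct_strength_comp_map,
      rightAdjunct_leftAdjunct]
    refine (adj.untranspose_transpose _).trans ?_
    rw [rightAdjunct, postcomp_id]
  · have h : l ≫ mapHom G (strength F z X) = adj.unitApp (z ⊙ X) := by
      apply rightAdjunct_injective
      rw [rightAdjunct_comp, rightAdjunct_leftAdjunct, ← transpose_postcomp]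
      change adj.transpose (rightAdjunct (strength F z X)) = postcomp _ _
      rw [strength, rightAdjunct_leftAdjunct, postcomp_unitApp, transpose, Category.assoc]
    have h2 : mapHom F (mapHom G (strength F z X)) ≫ adj.counitApp _ =
      adj.counitApp _ ≫ strength F z X := adj.mapHom_mapHom_counitApp _
    rw [Category.assoc, ← h2, ← Category.assoc, ← mapHom_comp, h, mapHom_unitApp_counitApp]

end EnrichedAdjunction
end LeftAdjoints

/-! ### Associativity of tensors and strengths -/

section Tensors
variable {C : Type u} [Category.{v} C] [MonoidalCategory C] [SymmetricCategory C]
  [MonoidalClosed C] {D : Type u₁} [EnrichedCategory C D] [Tensored C D]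
  {E : Type u₂} [EnrichedCategory C E] [Tensored C E]

omit [SymmetricCategory C] in
lemma rightAdjunct_id (z : C) (X : D) : rightAdjunct (𝟙 (of C (z ⊙ X))) = cv z X :=
  postcomp_id _

omit [SymmetricCategory C] in
lemma rightAdjunct_tensorHom {z z' : C} {X X' : D} (f : z ⟶ z') (g : of C X ⟶ of C X') :
    rightAdjunct (tensorHom f g) = f ≫ precomp g (cv z' X') :=
  rightAdjunct_leftAdjunct _

omit [SymmetricCategory C] in
lemma rightAdjunct_tensorHom_id_comp {z : C} {X X' Y : D} (g : of C X ⟶ of C X')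
    (l : of C (z ⊙ X') ⟶ of C Y) :
    rightAdjunct (tensorHom (𝟙 z) g ≫ l) = precomp g (rightAdjunct l) := by
  rw [rightAdjunct_tensorHom_comp, Category.id_comp]

lemma eMul_cv_rightAdjunct_tensorAssoc (w z : C) (X : D) :
    eMul (cv z X) (rightAdjunct (tensorAssoc w z X)) = (β_ z w).hom ≫ cv (w ⊗ z) X := by
  rw [tensorAssoc, rightAdjunct_leftAdjunct, eMul_cv_eDesc]

omit [SymmetricCategory C] in
lemma eMul_cv_precomp {z t : C} {X Y Z : D} (l : of C (z ⊙ X) ⟶ of C Y) (f : t ⟶ (Y ⟶[C] Z)) :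
    eMul (cv z X) (precomp l f) = eMul (rightAdjunct l) f := eMul_precomp _ _ _

instance isIso_tensorAssoc (w z : C) (X : D) : IsIso (tensorAssoc w z X) := by
  refine ⟨leftAdjunct ((β_ w z).hom ≫ eMul (cv z X) (cv w (z ⊙ X))), ?_, ?_⟩
  · apply rightAdjunct_injective
    apply eMul_cv_injective
    rw [eMul_cv_rightAdjunct_tensorAssoc_comp, rightAdjunct_leftAdjunct,
      SymmetricCategory.symmetry_assoc, rightAdjunct_id]
  · apply rightAdjunct_injective
    rw [rightAdjunct_comp, rightAdjunct_leftAdjunct, comp_postcomp, ← eMul_postcomp]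
    change _ ≫ eMul _ (rightAdjunct _) = _
    rw [eMul_cv_rightAdjunct_tensorAssoc, SymmetricCategory.symmetry_assoc, rightAdjunct_id]

lemma tensorAssoc_naturality (w z : C) {X Y : D} (g : of C X ⟶ of C Y) :
    tensorHom (𝟙 w) (tensorHom (𝟙 z) g) ≫ tensorAssoc w z Y =
      tensorAssoc w z X ≫ tensorHom (𝟙 (w ⊗ z)) g := by
  apply rightAdjunct_injective
  apply eMul_cv_injective
  rw [rightAdjunct_tensorHom_id_comp, eMul_cv_precomp, rightAdjunct_tensorHom, Category.id_comp,
    ← precomp_eMul, eMul_cv_rightAdjunct_tensorAssoc, eMul_cv_rightAdjunct_tensorAssoc_comp,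
    rightAdjunct_tensorHom, Category.id_comp, comp_precomp]

variable (F : EnrichedFunctor C D E)

omit [SymmetricCategory C] in
lemma rightAdjunct_strength (z : C) (X : D) :
    rightAdjunct (strength F z X) = cv z X ≫ F.map X (z ⊙ X) :=
  rightAdjunct_leftAdjunct _

omit [SymmetricCategory C] in
lemma tensorHom_strength {z z' : C} {X X' : D} (f : z ⟶ z') (g : of C X ⟶ of C X') :
    tensorHom f (mapHom F g) ≫ strength F z' X' =
      strength F z X ≫ mapHom F (tensorHom f g) := by
  apply rightAdjunct_injective
  rw [rightAdjunct_tensorHom_comp, rightAdjunct_strength, rightAdjunct_strength_comp_map,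
    rightAdjunct_tensorHom, Category.assoc, precomp_map]

lemma strength_tensorAssoc (w z : C) (X : D) :
    tensorHom (𝟙 w) (strength F z X) ≫ strength F w (z ⊙ X) ≫ mapHom F (tensorAssoc w z X) =
      tensorAssoc w z (F.obj X) ≫ strength F (w ⊗ z) X := by
  apply rightAdjunct_injective
  apply eMul_cv_injective
  rw [rightAdjunct_tensorHom_id_comp, eMul_cv_precomp, rightAdjunct_strength_comp_map,
    rightAdjunct_strength, ← eMul_map, eMul_cv_rightAdjunct_tensorAssoc,
    eMul_cv_rightAdjunct_tensorAssoc_comp, rightAdjunct_strength, Category.assoc]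

end Tensors

/-! ### Relative tensor products as coequalizers -/

section Coequalizers
variable {C : Type u} [Category.{v} C] [MonoidalCategory C] [SymmetricCategory C]
  [MonoidalClosed C] {b : C} [MonObj b]
  {D : Type u₁} [EnrichedCategory C D] [Tensored C D]

lemma IsRelTensor.existsUnique_desc {z : RightMod b} {X : LeftModObj b D} {P Y : D}
    {k : of C (z.X ⊙ X.X) ⟶ of C P} (hk : IsRelTensor z X (rightAdjunct k))
    (l : of C (z.X ⊙ X.X) ⟶ of C Y) (hl : relLeft z X ≫ l = relRight z X ≫ l) :
    ∃! d : of C P ⟶ of C Y, k ≫ d = l := by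
  obtain ⟨f, hf, hf'⟩ := hk.existsUnique _ ((isBalanced_rightUnitor_comp_iff z X _).2
    ((relLeft_eq_relRight_iff l).1 hl))
  refine ⟨ofHom f, rightAdjunct_injective ?_, fun d hd ↦ hf' _ ?_⟩
  · rw [rightAdjunct_comp]
    exact (Iso.inv_comp_eq _).2 hf
  · rw [← hd, rightAdjunct_comp]
    exact (Iso.hom_inv_id_assoc _ _).symm

/-- The underlying coequalizer of a relative tensor product given by its enriched universal
property. -/
lemma IsRelTensor.nonempty_isColimit {z : RightMod b} {X : LeftModObj b D} {P : D}
    {k : of C (z.X ⊙ X.X) ⟶ of C P} (hk : IsRelTensor z X (rightAdjunct k))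
    (w : relLeft z X ≫ k = relRight z X ≫ k) : Nonempty (IsColimit (Cofork.ofπ k w)) :=
  ⟨Cofork.IsColimit.ofExistsUnique fun s ↦
    hk.existsUnique_desc (Y := ForgetEnrichment.to C s.pt) s.π s.condition⟩

variable [HasEqualizers C]

lemma tensorHom_relLeft_tensorAssoc (w : C) (z : RightMod b) (X : LeftModObj b D) :
    tensorHom (𝟙 w) (relLeft z X) ≫ tensorAssoc w z.X X.X =
      tensorAssoc w z.X (b ⊙ X.X) ≫ relLeft (w ⊙ z) X := by
  apply rightAdjunct_injective
  apply eMul_cv_injective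
  apply eMul_cv_injective
  have h1 := eMul_cv_rightAdjunct_relLeft (z := z) (X := X) (𝟙 _)
  have h2 := eMul_cv_rightAdjunct_relLeft (z := w ⊙ z) (X := X) (𝟙 _)
  rw [Category.comp_id, rightAdjunct_id] at h1 h2
  have h3 := eMul_assoc (cv b X.X) (rightAdjunct (relLeft z X))
    (rightAdjunct (tensorAssoc w z.X X.X))
  rw [h1, ← Iso.inv_comp_eq] at h3
  rw [rightAdjunct_tensorHom_id_comp, eMul_cv_precomp, ← h3, comp_eMul, comp_eMul,
    eMul_cv_rightAdjunct_tensorAssoc, eMul_cv_rightAdjunct_tensorAssoc_comp, eMul_comp, h2,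
    BraidedCategory.braiding_naturality_left_assoc]
  change _ = _ ≫ _ ≫ ((α_ w z.X b).hom ≫ w ◁ z.act) ≫ _
  simp only [← Category.assoc]
  congr 1
  congr 1
  change _ = (_ ≫ (β_ b (w ⊗ z.X)).hom) ≫ _
  simp [BraidedCategory.braiding_tensor_left_hom, BraidedCategory.braiding_tensor_right_hom,
    BraidedCategory.yang_baxter]

lemma tensorHom_relRight_tensorAssoc (w : C) (z : RightMod b) (X : LeftModObj b D) :
    tensorHom (𝟙 w) (relRight z X) ≫ tensorAssoc w z.X X.X =
      tensorAssoc w z.X (b ⊙ X.X) ≫ relRight (w ⊙ z) X :=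
  tensorAssoc_naturality w z.X X.act

variable [HasCoequalizers (ForgetEnrichment C D)]

/-- If `w ⊙ -` preserves the coequalizer of `z ⊙ b ⊙ X ⇉ z ⊙ X`, then `w ⊙ (z ⊛_b X)` and
`(w ⊙ z) ⊛_b X` are coequalizers of isomorphic pairs. -/
lemma relTensorIsEnriched_of_preservesCoequalizers (X : LeftModObj b D)
    (h : ∀ w : C, PreservesColimitsOfShape WalkingParallelPair (tensorLeftFunctor D w)) :
    RelTensorIsEnriched X := by
  intro w z
  have := h w
  have hc : IsColimit (Cofork.ofπ (f := tensorHom (𝟙 w) (relLeft z X))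
      (g := tensorHom (𝟙 w) (relRight z X)) (tensorHom (𝟙 w) (cq z X)) _) :=
    isColimitCoforkMapOfIsColimit (tensorLeftFunctor D w) _
      (coequalizerIsCoequalizer (relLeft z X) (relRight z X))
  obtain ⟨p, hp⟩ := Cofork.IsColimit.desc' hc (tensorAssoc w z.X X.X ≫ cq (w ⊙ z) X) (by
    rw [← Category.assoc, tensorHom_relLeft_tensorAssoc, Category.assoc, relLeft_cq,
      ← Category.assoc, ← tensorHom_relRight_tensorAssoc, Category.assoc])
  have hq : relLeft (w ⊙ z) X ≫ inv (tensorAssoc w z.X X.X) ≫ tensorHom (𝟙 w) (cq z X) =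
      relRight (w ⊙ z) X ≫ inv (tensorAssoc w z.X X.X) ≫ tensorHom (𝟙 w) (cq z X) := by
    rw [← cancel_epi (tensorAssoc w z.X (b ⊙ X.X))]
    simp only [← Category.assoc]
    rw [← tensorHom_relLeft_tensorAssoc, ← tensorHom_relRight_tensorAssoc]
    simp only [Category.assoc, IsIso.hom_inv_id_assoc]
    rw [← tensorHom_id_comp, ← tensorHom_id_comp, relLeft_cq]
  have hp' : tensorHom (𝟙 w) (cq z X) ≫ p = tensorAssoc w z.X X.X ≫ cq (w ⊙ z) X := hp
  refine ⟨⟨p, relDesc _ hq, Cofork.IsColimit.hom_ext hc ?_, cq_hom_ext ?_⟩, hp'⟩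
  · change tensorHom (𝟙 w) (cq z X) ≫ p ≫ relDesc _ hq = tensorHom (𝟙 w) (cq z X) ≫ 𝟙 _
    rw [← Category.assoc, hp', Category.assoc, cq_relDesc, IsIso.hom_inv_id_assoc,
      Category.comp_id]
  · rw [← Category.assoc, cq_relDesc, Category.assoc, hp', IsIso.inv_hom_id_assoc,
      Category.comp_id]

/-! ### Invertibility of the canonical transformation -/

lemma preservesRegularColimits_of_isIso_lambdaApp (F : EnrichedFunctor C (RightMod b) D)
    (h : RelTensorIsEnriched (evalRegular F)) [∀ z, IsIso (lambdaApp F z)] :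
    PreservesRegularColimits F := by
  intro z
  rw [← postcomp_cq_lambdaApp_eq_actMap]
  exact (h.isRelTensor_cq z).postcomp _

variable {F : EnrichedFunctor C (RightMod b) D}

variable (F) in
/-- The strength `z ⊙ F(b_b) ⟶ F(z ⊙ b_b)`. -/
def regularStrength (z : C) :
    of C (z ⊙ (evalRegular F).X) ⟶ of C (F.obj (z ⊙ RightMod.regular b)) :=
  strength F z (RightMod.regular b)

variable (F) in
omit [HasCoequalizers (ForgetEnrichment C D)] in
/-- The strength of `F` carries the two actions `z ⊙ b ⊙ F(b_b) ⇉ z ⊙ F(b_b)` to the image under `F`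
of the two actions `z ⊙ b ⊙ b_b ⇉ z ⊙ b_b`; this is the action on `z`. -/
lemma tensorHom_strength_relLeft (z : RightMod b) :
    tensorHom (𝟙 z.X) (regularStrength F b) ≫ strength F z.X (b ⊙ RightMod.regular b) ≫
      mapHom F (relLeft z (RightMod.regularObj b)) =
      relLeft z (evalRegular F) ≫ regularStrength F z.X := by
  have h := tensorHom_strength F z.act (𝟙 (of C (RightMod.regular b)))
  have h2 : mapHom F (𝟙 (of C (RightMod.regular b))) = 𝟙 _ := F.forget.map_id _
  rw [h2] at h
  have h3 := strength_tensorAssoc F z.X b (RightMod.regular b)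
  calc _ = (tensorHom (𝟙 z.X) (strength F b (RightMod.regular b)) ≫
        strength F z.X (b ⊙ RightMod.regular b) ≫
        mapHom F (tensorAssoc z.X b (RightMod.regular b))) ≫
        mapHom F (tensorHom z.act (𝟙 (of C (RightMod.regular b)))) := by
        rw [relLeft, mapHom_comp, Category.assoc, Category.assoc]
        rfl
    _ = tensorAssoc z.X b (F.obj (RightMod.regular b)) ≫
        tensorHom z.act (𝟙 (of C (F.obj (RightMod.regular b)))) ≫
        strength F z.X (RightMod.regular b) := by
        rw [h3, Category.assoc, ← h]
    _ = _ := (Category.assoc _ _ _).symm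

variable (F) in
omit [HasCoequalizers (ForgetEnrichment C D)] in
lemma tensorHom_strength_relRight (z : RightMod b) :
    tensorHom (𝟙 z.X) (regularStrength F b) ≫ strength F z.X (b ⊙ RightMod.regular b) ≫
      mapHom F (relRight z (RightMod.regularObj b)) =
      relRight z (evalRegular F) ≫ regularStrength F z.X := by
  rw [relRight, ← tensorHom_strength, ← Category.assoc, ← tensorHom_id_comp]
  rfl

lemma cq_lambdaApp (z : RightMod b) : cq z (evalRegular F) ≫ lambdaApp F z =
    regularStrength F z.X ≫ mapHom F (RightMod.actHom z) :=
  cq_relDesc _ _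

/-- `F` sends the coequalizer `z ⊙ b ⊙ b_b ⇉ z ⊙ b_b ⟶ z` to a coequalizer, and its strengths
identify the image with the coequalizer defining `z ⊛_b F(b_b)`. -/
lemma isIso_lambdaApp (hT : PreservesTensors F)
    [PreservesColimitsOfShape WalkingParallelPair F.forget] (z : RightMod b) :
    IsIso (lambdaApp F z) := by
  have hs : IsIso (regularStrength F z.X) := hT _ _
  have hs2 : IsIso (strength F z.X (b ⊙ RightMod.regular b)) := hT _ _
  have hs3 : IsIso (regularStrength F b) := hT _ _
  have : IsIso (tensorHom (𝟙 z.X) (regularStrength F b)) :=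
    inferInstanceAs (IsIso ((tensorLeftFunctor D z.X).map (regularStrength F b)))
  have w : relLeft z (RightMod.regularObj b) ≫ RightMod.actHom z =
      relRight z (RightMod.regularObj b) ≫ RightMod.actHom z :=
    (relLeft_eq_relRight_iff _).2 (RightMod.eMul_rightAdjunct_actHom_actHom z).symm
  have hc : IsColimit (Cofork.ofπ (f := mapHom F (relLeft z (RightMod.regularObj b)))
      (g := mapHom F (relRight z (RightMod.regularObj b))) (mapHom F (RightMod.actHom z)) _) :=
    isColimitCoforkMapOfIsColimit F.forget _
      ((RightMod.isRelTensor_actHom z).nonempty_isColimit w).some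
  obtain ⟨p, hp⟩ := Cofork.IsColimit.desc' hc
      (inv (regularStrength F z.X) ≫ cq z (evalRegular F)) (by
    rw [← cancel_epi (strength F z.X (b ⊙ RightMod.regular b)),
      ← cancel_epi (tensorHom (𝟙 z.X) (regularStrength F b))]
    have h1 := tensorHom_strength_relLeft F z
    have h2 := tensorHom_strength_relRight F z
    rw [reassoc_of% h1, reassoc_of% h2, IsIso.hom_inv_id_assoc, relLeft_cq])
  have hp' : mapHom F (RightMod.actHom z) ≫ p =
    inv (regularStrength F z.X) ≫ cq z (evalRegular F) := hp
  refine ⟨p, cq_hom_ext ?_, Cofork.IsColimit.hom_ext hc ?_⟩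
  · rw [← Category.assoc, cq_lambdaApp, Category.assoc, hp', IsIso.hom_inv_id_assoc,
      Category.comp_id]
  · change mapHom F (RightMod.actHom z) ≫ p ≫ lambdaApp F z = mapHom F (RightMod.actHom z) ≫ 𝟙 _
    rw [← Category.assoc, hp', Category.assoc, cq_lambdaApp, IsIso.inv_hom_id_assoc,
      Category.comp_id]

lemma rightAdjunct_cq_lambdaApp (z : RightMod b) :
    rightAdjunct (cq z (evalRegular F) ≫ lambdaApp F z) = actMap F z := by
  rw [rightAdjunct_comp, postcomp_cq_lambdaApp_eq_actMap]

/-- Compatibility of `λ` with strengths, before `- ⊛_b F(b_b)` is known to be enriched. -/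
lemma tensorHom_lambdaApp_strength (w : C) (z : RightMod b) :
    tensorHom (𝟙 w) (cq z (evalRegular F)) ≫ tensorHom (𝟙 w) (lambdaApp F z) ≫ strength F w z =
      tensorAssoc w z.X (evalRegular F).X ≫ cq (w ⊙ z) (evalRegular F) ≫
        lambdaApp F (w ⊙ z) := by
  have h : z.X ◁ cv w z ≫ RightMod.homEv z (w ⊙ z) = (β_ z.X w).hom :=
    RightMod.whiskerLeft_homMk_homEv _ _ _ (RightMod.isLinear_braiding w z)
  rw [← Category.assoc, ← tensorHom_id_comp]
  apply rightAdjunct_injective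
  apply eMul_cv_injective
  rw [rightAdjunct_tensorHom_id_comp, eMul_cv_precomp, rightAdjunct_strength,
    rightAdjunct_cq_lambdaApp, eMul_actMap, h, eMul_cv_rightAdjunct_tensorAssoc_comp]
  exact congrArg (_ ≫ ·) (rightAdjunct_cq_lambdaApp (w ⊙ z)).symm

/-- If `λ` is invertible, the strengths of `F` can be transported to `- ⊛_b F(b_b)`. -/
lemma relTensorIsEnriched_of_preservesTensors (hT : PreservesTensors F)
    [∀ z, IsIso (lambdaApp F z)] : RelTensorIsEnriched (evalRegular F) := by
  intro w z
  have := hT w z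
  have : IsIso (tensorHom (𝟙 w) (lambdaApp F z)) :=
    inferInstanceAs (IsIso ((tensorLeftFunctor D w).map (lambdaApp F z)))
  refine ⟨asIso (tensorHom (𝟙 w) (lambdaApp F z)) ≪≫ asIso (strength F w z) ≪≫
    (asIso (lambdaApp F (w ⊙ z))).symm, ?_⟩
  have h := tensorHom_lambdaApp_strength (F := F) w z
  simp only [Iso.trans_hom, asIso_hom, Iso.symm_hom, asIso_inv]
  simp only [← Category.assoc] at h ⊢
  rw [IsIso.comp_inv_eq]
  exact h

end Coequalizers

end EnrichedModules
end

theorem proposition3p2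
    {C : Type u} [Category.{v} C] [MonoidalCategory C] [SymmetricCategory C] [MonoidalClosed C]
    [HasFiniteLimits C] [HasFiniteColimits C]
    {b : C} [MonObj b]
    {D : Type u₁} [EnrichedCategory C D] [Tensored C D]
    [HasCoequalizers (ForgetEnrichment C D)]
    (F : EnrichedFunctor C (RightMod b) D) :
    List.TFAE
      [IsEnrichedLeftAdjoint F,
        IsEnrichedCocontinuous.{w} F,
        PreservesTensors F ∧ PreservesColimitsOfShape WalkingParallelPair F.forget,
        ∃ h : RelTensorIsEnriched (evalRegular F), (lambda F h).IsInvertible] ∧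
      ((∀ x : C, PreservesColimitsOfShape WalkingParallelPair (tensorLeftFunctor D x)) →
        RelTensorIsEnriched (evalRegular F)) := by
  refine ⟨?_, relTensorIsEnriched_of_preservesCoequalizers _⟩
  have key : PreservesRegularColimits F → IsEnrichedLeftAdjoint F := fun h ↦ ⟨_, ⟨h.adjunction⟩⟩
  tfae_have 1 → 2 := fun ⟨_, ⟨adj⟩⟩ ↦ adj.isEnrichedCocontinuous
  tfae_have 2 → 1 := fun h ↦ key h.preservesRegularColimits
  tfae_have 1 → 3 := fun ⟨_, ⟨adj⟩⟩ ↦ by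
    have := adj.forgetAdjunction.leftAdjoint_preservesColimits
    exact ⟨adj.preservesTensors, inferInstance⟩
  tfae_have 3 → 4 := fun ⟨hT, _⟩ ↦ by
    have := isIso_lambdaApp hT
    refine ⟨relTensorIsEnriched_of_preservesTensors hT, ?_⟩
    have (z : RightMod b) :
        IsIso ((lambda F (relTensorIsEnriched_of_preservesTensors hT)).app z) := this z
    exact EnrichedTrans.isInvertible_of_isIso _
  tfae_have 4 → 1 := fun ⟨h, hl⟩ ↦ by
    have (z : RightMod b) : IsIso (lambdaApp F z) := hl.isIso_app z
    exact key (preservesRegularColimits_of_isIso_lambdaApp F h)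
  tfae_finish
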